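/- All manifolds are finite-dimensional, smooth and without boundary, and all maps, forms and bundles are smooth. **Notation.** For a fibre bundle $\epsilon:P\to Q$ put $T_PQ=TQ\times_QP=\{(v,p): v\in T_{\epsilon(p)}Q\}$ and $T_P^*Q=T^*Q\times_QP$, with the projections $\tau_1:T_PQ\to TQ$, $\tau_2:T_PQ\to P$, $\pi_1:T^*_PQ\to T^*Q$, $\pi_2:T_P^*Q\to P$. A *magnetic Lagrangian system* $(\epsilon,L,\mathcal B)$ consists of a fibre bundle $\epsilon:P\to Q$, a smooth function $L$ on $T_PQ$ and a closed $2$-form $\mathcal B$ on $P$. Its fibre derivative $\mathbb FL:T_PQ\to T_P^*Q$ is $\mathbb FL(v,p)=(\alpha,p)$ with $\langle\alpha,w\rangle=\frac{d}{du}\big|_{u=0}L(v+uw,p)$ for $w\in T_{\epsilon(p)}Q$; its energy is $E_L(v,p)=\langle\mathbb FL(v,p),(v,p)\rangle-L(v,p)$; its Poincaré–Cartan $2$-form is $\Omega^{L,\mathcal B}=\mathbb FL^*(\pi_1^*\omega_Q+\pi_2^*\mathcal B)$, where $\omega_Q=d\theta_Q$ and $\theta_Q$ is the canonical $1$-form on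 $T^*Q$ (in coordinates $\omega_Q=dp_i\wedge dq^i$). Let $\epsilon^{(1)}:P_1\to Q_1$ and $\epsilon^{(2)}:P_2\to Q_2$ be fibre bundles. A *transformation pair* $(F,f)$ between them consists of surjective submersions $F:P_1\to P_2$ and $f:Q_2\to Q_1$, both fibre bundles, with $f\circ\epsilon^{(2)}\circ F=\epsilon^{(1)}$. Points $(v_1,p_1)\in T_{P_1}Q_1$ and $(v_2,p_2)\in T_{P_2}Q_2$ are *compatible* if $F(p_1)=p_2$ and $Tf(v_2)=v_1$; a smooth map $\psi:T_{P_1}Q_1\to T_{P_2}Q_2$ is *compatible* if $s$ and $\psi(s)$ are compatible for all $s$. Let $Vf=\ker Tf\subset TQ_2$, let $V^*f$ be the dual bundle, and for a function $L_2$ on $T_{P_2}Q_2$ let $\alpha_{L_2}:T_{P_2}Q_2\to V^*f$ be $\pi_1\circ\mathbb FL_2$ followed by restriction of covectors to $Vf$. The function $L_2$ is *$f$-regular* if for every $(v,p)\in T_{P_2}Q_2$, with $q=\epsilon^{(2)}(p)$, the map $V_qf\to V_q^*f$, $w\mapsto\alpha_{L_2}(v+w,p)$, is a diffeomorphism. A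 *connection* on $f$ is a $Vf$-valued $1$-form $\mathcal A$ on $Q_2$ with $\mathcal A(w)=w$ for all $w\in Vf$. **Theorem.** Let $(F,f)$ be a transformation pair between $\epsilon^{(1)}$ and $\epsilon^{(2)}$, let $(\epsilon^{(2)},L_2,\mathcal B_2)$ be a magnetic Lagrangian system with $L_2$ $f$-regular, let $\mathcal A$ be a connection on $f:Q_2\to Q_1$, and let $\beta:P_1\to V^*f$ be a smooth map covering $\epsilon^{(2)}\circ F$, that is, $\beta(p_1)\in V^*_{\epsilon^{(2)}(F(p_1))}f$. For $s=(v_1,p_1)\in T_{P_1}Q_1$ choose a compatible point $(v_2,p_2)$, let $w\in V_{\epsilon^{(2)}(p_2)}f$ be the unique vertical vector with $\alpha_{L_2}(v_2+w,p_2)=\beta(p_1)$, and put $\psi_{L_2,\beta}(s)=(v_2+w,p_2)$, which does not depend on the choice of $v_2$. Write $\psi^{TQ_2}_{L_2,\beta}=\tau_1\circ\psi_{L_2,\beta}$ and $\mathcal A_{P_1}(v)=\mathcal A\big(T(\epsilon^{(2)}\circ F)(v)\big)$ for $v\in TP_1$, and define $$L_1(v_1,p_1)=L_2\big(\psi_{L_2,\beta}(v_1,p_1)\big)-\big\langle\beta(p_1),\mathcal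 A\big(\psi^{TQ_2}_{L_2,\beta}(v_1,p_1)\big)\big\rangle,\qquad \mathcal B_1=F^*\mathcal B_2+d\langle\beta,\mathcal A_{P_1}\rangle .$$ Then $\psi_{L_2,\beta}$ is a (smooth) compatible map, $(\epsilon^{(1)},L_1,\mathcal B_1)$ is a magnetic Lagrangian system, and $$\psi_{L_2,\beta}^*\Omega^{L_2,\mathcal B_2}=\Omega^{L_1,\mathcal B_1},\qquad \psi_{L_2,\beta}^*E_{L_2}=E_{L_1}.$$ -/

import Mathlib

open scoped Manifold ContDiff
open Bundle Topology
set_option linter.unusedSectionVars false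

noncomputable section

namespace MagLag

universe uP

/-! ### Differential forms on manifolds without boundary -/

section Forms

variable {E : Type*} [NormedAddCommGroup E] [NormedSpace ℝ E]
  {H : Type*} [TopologicalSpace H] (I : ModelWithCorners ℝ E H)
  {M : Type*} [TopologicalSpace M] [ChartedSpace H M]
  {E' : Type*} [NormedAddCommGroup E'] [NormedSpace ℝ E']
  {H' : Type*} [TopologicalSpace H'] (J : ModelWithCorners ℝ E' H')
  {N : Type*} [TopologicalSpace N] [ChartedSpace H' N]

/-- A (not necessarily smooth) differential `k`-form on the manifold `M`: an alternating `k`-linear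
form on every tangent space. -/
abbrev DForm (M : Type*) [TopologicalSpace M] [ChartedSpace H M] (k : ℕ) : Type _ :=
  ∀ x : M, (TangentSpace I x) [⋀^Fin k]→L[ℝ] ℝ

variable {I} {J}

/-- The coordinate expression of a form in the preferred chart at `x₀`: the pull-back of the form
under the inverse of that chart. It is meaningful on the target of the chart. -/
def DForm.inChart {k : ℕ} (η : DForm I M k) (x₀ : M) : E → E [⋀^Fin k]→L[ℝ] ℝ := fun y =>
  (η ((extChartAt I x₀).symm y)).compContinuousLinearMap
    (mfderivWithin 𝓘(ℝ, E) I (extChartAt I x₀).symm (Set.range I) y)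

/-- A form is smooth if its coordinate expressions are smooth. -/
def DForm.IsSmooth {k : ℕ} (η : DForm I M k) : Prop :=
  ∀ x₀ : M, ContDiffOn ℝ ∞ (η.inChart x₀) (extChartAt I x₀).target

/-- The exterior derivative: at `x` it is computed in the preferred chart at `x`. -/
def DForm.d {k : ℕ} (η : DForm I M k) : DForm I M (k + 1) := fun x =>
  (extDerivWithin (η.inChart x) (Set.range I) (extChartAt I x x)).compContinuousLinearMap
    (mfderiv I 𝓘(ℝ, E) (extChartAt I x) x)

/-- The pull-back `g^* η` of a form under a (differentiable) map `g`. -/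
def DForm.pullback {k : ℕ} (g : M → N) (η : DForm J N k) : DForm I M k := fun x =>
  (η (g x)).compContinuousLinearMap (mfderiv I J g x)

/-- A field of covectors, seen as a `1`-form. -/
def oneForm (a : ∀ x : M, TangentSpace I x →L[ℝ] ℝ) : DForm I M 1 := fun x =>
  ContinuousAlternatingMap.ofSubsingleton ℝ (TangentSpace I x) ℝ (0 : Fin 1) (a x)

end Forms

/-! ### Fibre bundles, vertical vectors, connections -/

section FibreBundles

variable {E : Type*} [NormedAddCommGroup E] [NormedSpace ℝ E]
  {E' : Type*} [NormedAddCommGroup E'] [NormedSpace ℝ E']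
  {M : Type uP} [TopologicalSpace M] [ChartedSpace E M]
  {N : Type*} [TopologicalSpace N] [ChartedSpace E' N]

/-- A smooth map is (the projection of) a smooth fibre bundle if it is surjective and smoothly
locally trivial: around each point `x` of the base there are a fibre manifold `Y` and a local
trivialization `e : p⁻¹(U) → U × Y` over `U = e.baseSet` which is a diffeomorphism. -/
structure IsSmoothFiberBundle (p : C^∞⟮𝓘(ℝ, E), M; 𝓘(ℝ, E'), N⟯) : Prop where
  surjective : Function.Surjective p
  locallyTrivial : ∀ x : N, ∃ (m : ℕ) (Y : Type uP) (_ : TopologicalSpace Y)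
    (_ : ChartedSpace (EuclideanSpace ℝ (Fin m)) Y) (_ : IsManifold (𝓡 m) ∞ Y)
    (e : Trivialization Y p), x ∈ e.baseSet ∧
      ContMDiffOn 𝓘(ℝ, E) (𝓘(ℝ, E').prod (𝓡 m)) ∞ e e.source ∧
      ContMDiffOn (𝓘(ℝ, E').prod (𝓡 m)) 𝓘(ℝ, E) ∞ e.toOpenPartialHomeomorph.symm e.target

/-- A surjective submersion. -/
structure IsSurjectiveSubmersion (p : C^∞⟮𝓘(ℝ, E), M; 𝓘(ℝ, E'), N⟯) : Prop where
  surjective : Function.Surjective p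
  mfderiv_surjective : ∀ x : M, Function.Surjective (mfderiv 𝓘(ℝ, E) 𝓘(ℝ, E') p x)

/-- The vertical space `V_x p = ker T_x p`, as a subspace of `T_x M` (which in Mathlib is the model
space `E` under another name; written with `E` here, it inherits the norm of `E`). -/
def vert (p : C^∞⟮𝓘(ℝ, E), M; 𝓘(ℝ, E'), N⟯) (x : M) : Submodule ℝ E :=
  LinearMap.ker (mfderiv 𝓘(ℝ, E) 𝓘(ℝ, E') p x : TangentSpace 𝓘(ℝ, E) x →L[ℝ] _).toLinearMap

/-- The fibre `V_x^* p` of the bundle dual to the vertical bundle. -/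
abbrev VDual (p : C^∞⟮𝓘(ℝ, E), M; 𝓘(ℝ, E'), N⟯) (x : M) : Type _ := vert p x →L[ℝ] ℝ

/-- The inclusion `V_x p → T_x M`. -/
def vertIncl (p : C^∞⟮𝓘(ℝ, E), M; 𝓘(ℝ, E'), N⟯) (x : M) :
    vert p x →L[ℝ] TangentSpace 𝓘(ℝ, E) x := (vert p x).subtypeL

/-- The cotangent bundle of `M`. -/
abbrev Cotangent (E : Type*) [NormedAddCommGroup E] [NormedSpace ℝ E]
    (M : Type*) [TopologicalSpace M] [ChartedSpace E M] : Type _ :=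
  TotalSpace (E →L[ℝ] ℝ) (fun x : M => TangentSpace 𝓘(ℝ, E) x →L[ℝ] ℝ)

variable [IsManifold 𝓘(ℝ, E) ∞ M]

/-- A connection on `p : M → N`: a smooth `V p`-valued `1`-form on `M` which is the identity on
vertical vectors. -/
structure Connection (p : C^∞⟮𝓘(ℝ, E), M; 𝓘(ℝ, E'), N⟯) where
  toFun : ∀ x : M, TangentSpace 𝓘(ℝ, E) x →L[ℝ] vert p x
  contMDiff : ContMDiff 𝓘(ℝ, E) (𝓘(ℝ, E).prod 𝓘(ℝ, E →L[ℝ] E)) ∞ (fun x : M =>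
    (TotalSpace.mk' (E →L[ℝ] E) x (vertIncl p x ∘L toFun x) :
      TotalSpace (E →L[ℝ] E)
        (fun x : M => TangentSpace 𝓘(ℝ, E) x →L[ℝ] TangentSpace 𝓘(ℝ, E) x)))
  apply_vert : ∀ (x : M) (w : vert p x), toFun x (vertIncl p x w) = w

/-- A smooth map `β : S → V^* p` covering `g : S → M`. The dual vertical bundle `V^* p` is the
quotient of `T^*M` by the covectors that vanish on vertical vectors, and restriction to vertical
vectors `T^*M → V^* p` is a surjective submersion; so smoothness of `β` means that `β` lifts,
locally, to smooth maps into `T^*M`. -/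
structure VDualMap {ES : Type*} [NormedAddCommGroup ES] [NormedSpace ℝ ES]
    {S : Type*} [TopologicalSpace S] [ChartedSpace ES S]
    (p : C^∞⟮𝓘(ℝ, E), M; 𝓘(ℝ, E'), N⟯) (g : S → M) where
  toFun : ∀ s : S, VDual p (g s)
  smooth : ∀ s₀ : S, ∃ U : Set S, IsOpen U ∧ s₀ ∈ U ∧
    ∃ b : ∀ s : S, TangentSpace 𝓘(ℝ, E) (g s) →L[ℝ] ℝ,
      ContMDiffOn 𝓘(ℝ, ES) (𝓘(ℝ, E).prod 𝓘(ℝ, E →L[ℝ] ℝ)) ∞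
        (fun s => (⟨g s, b s⟩ : Cotangent E M)) U ∧
      ∀ s ∈ U, b s ∘L vertIncl p (g s) = toFun s

end FibreBundles

/-! ### Magnetic Lagrangian systems -/

section MagneticLagrangian

variable {EP : Type*} [NormedAddCommGroup EP] [NormedSpace ℝ EP]
  {EQ : Type*} [NormedAddCommGroup EQ] [NormedSpace ℝ EQ]
  {P : Type*} [TopologicalSpace P] [ChartedSpace EP P]
  {Q : Type*} [TopologicalSpace Q] [ChartedSpace EQ Q] [IsManifold 𝓘(ℝ, EQ) ∞ Q]
  (ε : C^∞⟮𝓘(ℝ, EP), P; 𝓘(ℝ, EQ), Q⟯)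

/-- The fibre product `T_P Q = TQ ×_Q P`, as the total space of the pull-back of `TQ` along `ε`.
Its points are written `⟨p, v⟩` with `v ∈ T_{ε p} Q`. -/
abbrev TP : Type _ := TotalSpace EQ (ε *ᵖ (TangentSpace 𝓘(ℝ, EQ) : Q → Type _))

/-- The fibre product `T_P^* Q = T^*Q ×_Q P`. -/
abbrev TPDual : Type _ :=
  TotalSpace (EQ →L[ℝ] ℝ) (ε *ᵖ (fun q : Q => TangentSpace 𝓘(ℝ, EQ) q →L[ℝ] ℝ))

/-- The model of the manifold `T_P Q`. -/
abbrev TPModel (EP EQ : Type*) [NormedAddCommGroup EP] [NormedSpace ℝ EP] [NormedAddCommGroup EQ]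
    [NormedSpace ℝ EQ] : ModelWithCorners ℝ (EP × EQ) (ModelProd EP EQ) :=
  𝓘(ℝ, EP).prod 𝓘(ℝ, EQ)

/-- The model of the manifold `T_P^* Q`. -/
abbrev TPDualModel (EP EQ : Type*) [NormedAddCommGroup EP] [NormedSpace ℝ EP]
    [NormedAddCommGroup EQ] [NormedSpace ℝ EQ] :
    ModelWithCorners ℝ (EP × (EQ →L[ℝ] ℝ)) (ModelProd EP (EQ →L[ℝ] ℝ)) :=
  𝓘(ℝ, EP).prod 𝓘(ℝ, EQ →L[ℝ] ℝ)

variable {ε}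

/-- The projection `τ₁ : T_P Q → TQ`. -/
def tau₁ (s : TP ε) : TangentBundle 𝓘(ℝ, EQ) Q := ⟨ε s.proj, s.snd⟩

/-- The projection `τ₂ : T_P Q → P`. -/
def tau₂ (s : TP ε) : P := s.proj

/-- The projection `π₁ : T_P^* Q → T^*Q`. -/
def pi₁ (s : TPDual ε) : Cotangent EQ Q := ⟨ε s.proj, s.snd⟩

/-- The projection `π₂ : T_P^* Q → P`. -/
def pi₂ (s : TPDual ε) : P := s.proj

/-- The covector `α ∈ T_q^* Q`, `α(w) = d/du|_{u=0} L(v + u w, p)`, where `q = ε p`: the derivative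
at `v` of the restriction of `L` to the fibre `T_q Q` over `p`. -/
def fiberCovector (L : TP ε → ℝ) (s : TP ε) : TangentSpace 𝓘(ℝ, EQ) (ε s.proj) →L[ℝ] ℝ :=
  fderiv ℝ (fun v : EQ => L ⟨s.proj, v⟩) s.snd

/-- The fibre derivative (Legendre transformation) `𝔽L : T_P Q → T_P^* Q`. -/
def legendre (L : TP ε → ℝ) (s : TP ε) : TPDual ε := ⟨s.proj, fiberCovector L s⟩

/-- The energy `E_L(v, p) = ⟨𝔽L(v, p), (v, p)⟩ - L(v, p)`. -/
def energy (L : TP ε → ℝ) (s : TP ε) : ℝ := fiberCovector L s s.snd - L s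

variable (EQ Q) in
/-- The canonical `1`-form on `T^*Q`: `θ_α(X) = α(T pr(X))`, i.e. `θ = p_i dq^i`. -/
def canonicalOneForm : DForm (𝓘(ℝ, EQ).prod 𝓘(ℝ, EQ →L[ℝ] ℝ)) (Cotangent EQ Q) 1 :=
  oneForm fun a => a.snd ∘L
    mfderiv (𝓘(ℝ, EQ).prod 𝓘(ℝ, EQ →L[ℝ] ℝ)) 𝓘(ℝ, EQ) (fun b : Cotangent EQ Q => b.proj) a

variable (EQ Q) in
/-- The canonical symplectic form `ω_Q = dθ` on `T^*Q`, i.e. `ω_Q = dp_i ∧ dq^i`. -/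
def canonicalTwoForm : DForm (𝓘(ℝ, EQ).prod 𝓘(ℝ, EQ →L[ℝ] ℝ)) (Cotangent EQ Q) 2 :=
  (canonicalOneForm EQ Q).d

/-- The Poincaré-Cartan form `Ω^{L,B} = 𝔽L^*(π₁^* ω_Q + π₂^* B)` on `T_P Q`. -/
def poincareCartan (L : TP ε → ℝ) (B : DForm 𝓘(ℝ, EP) P 2) : DForm (TPModel EP EQ) (TP ε) 2 :=
  DForm.pullback (J := TPDualModel EP EQ) (legendre L)
    (DForm.pullback pi₁ (canonicalTwoForm EQ Q) + DForm.pullback pi₂ B)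

/-- `(ε, L, B)` is a magnetic Lagrangian system: `ε` is a fibre bundle, `L` is a smooth function on
`T_P Q` and `B` is a closed (smooth) `2`-form on `P`. -/
structure IsMagneticLagrangianSystem (ε : C^∞⟮𝓘(ℝ, EP), P; 𝓘(ℝ, EQ), Q⟯) (L : TP ε → ℝ)
    (B : DForm 𝓘(ℝ, EP) P 2) : Prop where
  fiberBundle : IsSmoothFiberBundle ε
  contMDiff_lagrangian : ContMDiff (TPModel EP EQ) 𝓘(ℝ) ∞ L
  smooth_magnetic : B.IsSmooth
  closed_magnetic : B.d = 0

end MagneticLagrangian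

/-! ### Transformation pairs and compatible transformations -/

section Transformations

variable {EP₁ : Type*} [NormedAddCommGroup EP₁] [NormedSpace ℝ EP₁]
  {EQ₁ : Type*} [NormedAddCommGroup EQ₁] [NormedSpace ℝ EQ₁]
  {EP₂ : Type*} [NormedAddCommGroup EP₂] [NormedSpace ℝ EP₂]
  {EQ₂ : Type*} [NormedAddCommGroup EQ₂] [NormedSpace ℝ EQ₂]
  {P₁ : Type*} [TopologicalSpace P₁] [ChartedSpace EP₁ P₁]
  {Q₁ : Type*} [TopologicalSpace Q₁] [ChartedSpace EQ₁ Q₁] [IsManifold 𝓘(ℝ, EQ₁) ∞ Q₁]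
  {P₂ : Type*} [TopologicalSpace P₂] [ChartedSpace EP₂ P₂]
  {Q₂ : Type*} [TopologicalSpace Q₂] [ChartedSpace EQ₂ Q₂] [IsManifold 𝓘(ℝ, EQ₂) ∞ Q₂]
  {ε₁ : C^∞⟮𝓘(ℝ, EP₁), P₁; 𝓘(ℝ, EQ₁), Q₁⟯} {ε₂ : C^∞⟮𝓘(ℝ, EP₂), P₂; 𝓘(ℝ, EQ₂), Q₂⟯}
  {F : C^∞⟮𝓘(ℝ, EP₁), P₁; 𝓘(ℝ, EP₂), P₂⟯} {f : C^∞⟮𝓘(ℝ, EQ₂), Q₂; 𝓘(ℝ, EQ₁), Q₁⟯}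

/-- `(F, f)` is a transformation pair between the fibre bundles `ε₁` and `ε₂`: `F` and `f` are
surjective submersions, `f ∘ ε₂ ∘ F = ε₁`, and all four maps are fibre bundles. -/
structure IsTransformationPair (ε₁ : C^∞⟮𝓘(ℝ, EP₁), P₁; 𝓘(ℝ, EQ₁), Q₁⟯)
    (ε₂ : C^∞⟮𝓘(ℝ, EP₂), P₂; 𝓘(ℝ, EQ₂), Q₂⟯) (F : C^∞⟮𝓘(ℝ, EP₁), P₁; 𝓘(ℝ, EP₂), P₂⟯)
    (f : C^∞⟮𝓘(ℝ, EQ₂), Q₂; 𝓘(ℝ, EQ₁), Q₁⟯) : Prop where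
  submersion_F : IsSurjectiveSubmersion F
  submersion_f : IsSurjectiveSubmersion f
  comm : ∀ p : P₁, f (ε₂ (F p)) = ε₁ p
  fiberBundle_ε₁ : IsSmoothFiberBundle ε₁
  fiberBundle_ε₂ : IsSmoothFiberBundle ε₂
  fiberBundle_F : IsSmoothFiberBundle F
  fiberBundle_f : IsSmoothFiberBundle f

/-- The points `s₁ = (v₁, p₁)` and `s₂ = (v₂, p₂)` are `(F, f)`-compatible: `F(p₁) = p₂` and
`Tf(v₂) = v₁`. -/
def Compatible (F : C^∞⟮𝓘(ℝ, EP₁), P₁; 𝓘(ℝ, EP₂), P₂⟯) (f : C^∞⟮𝓘(ℝ, EQ₂), Q₂; 𝓘(ℝ, EQ₁), Q₁⟯)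
    (s₁ : TP ε₁) (s₂ : TP ε₂) : Prop :=
  F (tau₂ s₁) = tau₂ s₂ ∧ tangentMap 𝓘(ℝ, EQ₂) 𝓘(ℝ, EQ₁) f (tau₁ s₂) = tau₁ s₁

/-- A compatible transformation `T_{P₁} Q₁ → T_{P₂} Q₂`. -/
structure IsCompatibleMap (F : C^∞⟮𝓘(ℝ, EP₁), P₁; 𝓘(ℝ, EP₂), P₂⟯)
    (f : C^∞⟮𝓘(ℝ, EQ₂), Q₂; 𝓘(ℝ, EQ₁), Q₁⟯) (ψ : TP ε₁ → TP ε₂) : Prop where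
  contMDiff : ContMDiff (TPModel EP₁ EQ₁) (TPModel EP₂ EQ₂) ∞ ψ
  compatible : ∀ s : TP ε₁, Compatible F f s (ψ s)

/-- The map `α_L : T_{P₂} Q₂ → V^* f`: the restriction of the covector `𝔽L(s)` to vertical
vectors. -/
def alpha (f : C^∞⟮𝓘(ℝ, EQ₂), Q₂; 𝓘(ℝ, EQ₁), Q₁⟯) (L : TP ε₂ → ℝ) (s : TP ε₂) :
    VDual f (ε₂ s.proj) :=
  fiberCovector L s ∘L vertIncl f (ε₂ s.proj)

/-- The point `(v + w, p)` for `s = (v, p)` and a vertical vector `w`. -/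
def addVert (f : C^∞⟮𝓘(ℝ, EQ₂), Q₂; 𝓘(ℝ, EQ₁), Q₁⟯) (s : TP ε₂) (w : vert f (ε₂ s.proj)) :
    TP ε₂ :=
  ⟨s.proj, (show TangentSpace 𝓘(ℝ, EQ₂) (ε₂ s.proj) from s.snd) + vertIncl f (ε₂ s.proj) w⟩

/-- `L` is `f`-regular: for every `s = (v, p)` the map `V_q f → V_q^* f`, `w ↦ α_L(v + w, p)`, is a
diffeomorphism. -/
def IsFRegular (f : C^∞⟮𝓘(ℝ, EQ₂), Q₂; 𝓘(ℝ, EQ₁), Q₁⟯) (L : TP ε₂ → ℝ) : Prop :=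
  ∀ s : TP ε₂, ∃ Φ : vert f (ε₂ s.proj) ≃ₘ^∞⟮𝓘(ℝ, vert f (ε₂ s.proj)),
    𝓘(ℝ, VDual f (ε₂ s.proj))⟯ VDual f (ε₂ s.proj), ∀ w, Φ w = alpha f L (addVert f s w)

/-- Compatibility for points over `p₁` and `F(p₁)`, as an equation in the model space of `Q₁`. -/
theorem IsTransformationPair.compatible_iff (h : IsTransformationPair ε₁ ε₂ F f)
    (s : TP ε₁) (v : TangentSpace 𝓘(ℝ, EQ₂) (ε₂ (F s.proj))) :
    Compatible F f s (⟨F s.proj, v⟩ : TP ε₂) ↔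
      (show EQ₁ from mfderiv 𝓘(ℝ, EQ₂) 𝓘(ℝ, EQ₁) f (ε₂ (F s.proj)) v) = (show EQ₁ from s.snd) := by
  constructor
  · rintro ⟨-, h2⟩
    have h3 := (TotalSpace.mk.injEq _ _ _ _).mp h2
    exact eq_of_heq h3.2
  · intro hv
    refine ⟨rfl, ?_⟩
    exact (TotalSpace.mk.injEq _ _ _ _).mpr ⟨h.comm s.proj, heq_of_eq hv⟩

/-- A compatible point over `F(p₁)` exists for every `s₁ = (v₁, p₁)`. -/
theorem IsTransformationPair.exists_compatible (h : IsTransformationPair ε₁ ε₂ F f)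
    (s : TP ε₁) : ∃ v : TangentSpace 𝓘(ℝ, EQ₂) (ε₂ (F s.proj)),
      Compatible F f s (⟨F s.proj, v⟩ : TP ε₂) := by
  obtain ⟨v, hv⟩ := h.submersion_f.mfderiv_surjective (ε₂ (F s.proj)) (show EQ₁ from s.snd)
  exact ⟨v, (h.compatible_iff s v).mpr hv⟩

/-- `f`-regularity gives the vertical correction of a given point. -/
theorem IsFRegular.existsUnique_vert {L : TP ε₂ → ℝ} (hL : IsFRegular f L) (s : TP ε₂)
    (b : VDual f (ε₂ s.proj)) : ∃! w : vert f (ε₂ s.proj), alpha f L (addVert f s w) = b := by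
  obtain ⟨Φ, hΦ⟩ := hL s
  refine ⟨Φ.symm b, ?_, fun w hw => ?_⟩
  · simp only [← hΦ]; exact Φ.apply_symm_apply b
  · rw [← hw, ← hΦ]; exact (Φ.symm_apply_apply w).symm

variable (h : IsTransformationPair ε₁ ε₂ F f) {L₂ : TP ε₂ → ℝ} (hL : IsFRegular f L₂)
  (β : VDualMap (ES := EP₁) f (fun p : P₁ => ε₂ (F p)))

/-- A point of `T_{P₂} Q₂` over `F(p₁)` that is compatible with `s₁ = (v₁, p₁)`. -/
def compatiblePoint (s : TP ε₁) : TP ε₂ := ⟨F s.proj, (h.exists_compatible s).choose⟩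

/-- The `TQ₂`-component of `ψ_{L₂,β}`: the vector `v₂ + w` where `(v₂, F(p₁))` is compatible
with `s₁ = (v₁, p₁)` and `w` is the vertical vector determined by `α_{L₂}(v₂ + w, F(p₁)) = β(p₁)`.
It does not depend on the choice of `v₂`, see `eq_psi_of_compatible`. -/
def psiTQ (s : TP ε₁) : TangentSpace 𝓘(ℝ, EQ₂) (ε₂ (F s.proj)) :=
  (addVert f (compatiblePoint h s)
    (hL.existsUnique_vert (compatiblePoint h s) (β.toFun s.proj)).choose).snd

/-- The compatible map `ψ_{L₂,β} : T_{P₁} Q₁ → T_{P₂} Q₂`. -/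
def psi (s : TP ε₁) : TP ε₂ := ⟨F s.proj, psiTQ h hL β s⟩

/-- `α_{L₂} ∘ ψ_{L₂,β} = β ∘ τ₂`. -/
theorem alpha_psi (s : TP ε₁) : alpha f L₂ (psi h hL β s) = β.toFun s.proj :=
  (hL.existsUnique_vert (compatiblePoint h s) (β.toFun s.proj)).choose_spec.1

/-- `ψ_{L₂,β}(s)` and `s` are compatible points. -/
theorem compatible_psi (s : TP ε₁) : Compatible F f s (psi h hL β s) := by
  refine (h.compatible_iff s _).mpr ?_
  have h1 := (h.compatible_iff s _).mp (h.exists_compatible s).choose_spec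
  have h2 := (hL.existsUnique_vert (compatiblePoint h s) (β.toFun s.proj)).choose.2
  have h3 := map_add (mfderiv 𝓘(ℝ, EQ₂) 𝓘(ℝ, EQ₁) f (ε₂ (F s.proj)))
    (h.exists_compatible s).choose
    (vertIncl f _ (hL.existsUnique_vert (compatiblePoint h s) (β.toFun s.proj)).choose)
  refine h3.trans ?_
  refine (congrArg₂ (fun a b : EQ₁ => a + b) h1 h2).trans ?_
  exact add_zero (show EQ₁ from s.snd)

/-- Independence of the choice: `ψ_{L₂,β}(s)` is the only compatible point with `α_{L₂} = β`. -/
theorem eq_psi_of_compatible (s : TP ε₁) (v : TangentSpace 𝓘(ℝ, EQ₂) (ε₂ (F s.proj)))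
    (hc : Compatible F f s (⟨F s.proj, v⟩ : TP ε₂))
    (ha : alpha f L₂ (⟨F s.proj, v⟩ : TP ε₂) = β.toFun s.proj) :
    v = psiTQ h hL β s := by
  have h1 := (h.compatible_iff s _).mp hc
  have h2 := (h.compatible_iff s _).mp (h.exists_compatible s).choose_spec
  set c : TangentSpace 𝓘(ℝ, EQ₂) (ε₂ (F s.proj)) := (h.exists_compatible s).choose with hcdef
  have hk : mfderiv 𝓘(ℝ, EQ₂) 𝓘(ℝ, EQ₁) f (ε₂ (F s.proj)) (v - c) = 0 := by
    rw [map_sub]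
    exact sub_eq_zero.mpr (h1.trans h2.symm)
  let w : vert f (ε₂ (F s.proj)) := ⟨v - c, hk⟩
  have hcw : c + vertIncl f (ε₂ (F s.proj)) w = v := add_sub_cancel c v
  have hE := hL.existsUnique_vert (compatiblePoint h s) (β.toFun s.proj)
  have hw : alpha f L₂ (addVert f (compatiblePoint h s) w) = β.toFun s.proj := by
    have key : ∀ x : TangentSpace 𝓘(ℝ, EQ₂) (ε₂ (F s.proj)), x = v →
        alpha f L₂ (⟨F s.proj, x⟩ : TP ε₂) = β.toFun s.proj := by
      intro x hx
      rw [hx]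
      exact ha
    exact key _ hcw
  have hu : w = hE.choose := hE.unique hw hE.choose_spec.1
  calc v = c + vertIncl f (ε₂ (F s.proj)) w := hcw.symm
    _ = psiTQ h hL β s := by rw [hu]; rfl

variable (A : Connection f)

/-- `L₁ = ψ_{L₂,β}^* L₂ - ⟨β, 𝒜(ψ_{L₂,β}^{TQ₂})⟩`. -/
def inducedLagrangian (s : TP ε₁) : ℝ :=
  L₂ (psi h hL β s) - β.toFun s.proj (A.toFun (ε₂ (F s.proj)) (psiTQ h hL β s))

/-- The `1`-form `⟨β, 𝒜_{P₁}⟩` on `P₁`, where `𝒜_{P₁}(v) = 𝒜(T(ε₂ ∘ F)(v))`. -/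
def betaConnection : DForm 𝓘(ℝ, EP₁) P₁ 1 :=
  oneForm fun p => β.toFun p ∘L A.toFun (ε₂ (F p)) ∘L
    mfderiv 𝓘(ℝ, EP₁) 𝓘(ℝ, EQ₂) (fun p : P₁ => ε₂ (F p)) p

/-- `B₁ = F^* B₂ + d⟨β, 𝒜_{P₁}⟩`. -/
def inducedMagnetic (B₂ : DForm 𝓘(ℝ, EP₂) P₂ 2) : DForm 𝓘(ℝ, EP₁) P₁ 2 :=
  DForm.pullback F B₂ + (betaConnection β A).d

end Transformations

end MagLag

end

open MagLag

/-! Fix `p₁` and let `γ(v)` be the `TQ₂`-component of `ψ(v, p₁)`. Everything rests on one fibrewise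
identity. Compatibility says `Tf ∘ γ = id`, so `Tf ∘ Dγ = id`. The defining equation of `ψ` says
that the covector `𝔽L₂(ψ) - ⟨β, 𝒜⟩` vanishes on vertical vectors, hence factors through `Tf`.
Differentiating `L₁ = L₂ ∘ γ - ⟨β, 𝒜 γ⟩` identifies the factor: `𝔽L₂(ψ(s))(Y) = 𝔽L₁(s)(Tf Y) + ⟨β, 𝒜
Y⟩` for all `Y` (`fiberCovector_inducedLagrangian`).

Taking `Y = γ(v)` gives the equality of energies. Taking for `Y` the image in `TQ₂` of a tangent
vector of `T_{P₁}Q₁` gives an identity of 1-forms, `ψ^* θ_{L₂} = θ_{L₁} + τ₂^*⟨β, 𝒜_{P₁}⟩`, where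
`θ_L` is the pull-back of the canonical 1-form by `π₁ ∘ 𝔽L`. Since `Ω^{L,B} = dθ_L + τ₂^* B`
(`poincareCartan_eq`) and `τ₂ ∘ ψ = F ∘ τ₂`, its exterior derivative is the equality of
Poincaré-Cartan forms. This uses that `d` commutes with pull-backs (`DForm.d_pullback`); closedness
of `B₁` also uses `d ∘ d = 0`.

The analytic point is smoothness of `ψ` (`contMDiff_psi`). The two conditions that determine `ψ`,
one on vertical vectors and one on `Tf`, are merged by means of the connection into a single
equation between spaces of equal dimension. `f`-regularity makes its linearization invertible, and
the implicit function theorem applies. -/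

namespace MagLag

/-! ### Smooth families of alternating forms on a vector space -/

section AlternatingComponents

variable {E : Type*} [NormedAddCommGroup E] [NormedSpace ℝ E] [FiniteDimensional ℝ E]
  {X : Type*} [NormedAddCommGroup X] [NormedSpace ℝ X]
  {E' : Type*} [NormedAddCommGroup E'] [NormedSpace ℝ E']

/-- An alternating form is determined by its values on tuples of basis vectors. This injective
linear map into a finite product has a linear left inverse, continuous by finite dimension, which
recovers `η` from its smooth coefficients. -/
theorem contDiffWithinAt_alternating_of_apply {k : ℕ} {n : WithTop ℕ∞}
    {η : X → E [⋀^Fin k]→L[ℝ] ℝ} {s : Set X} {x : X}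
    (hη : ∀ v : Fin k → E, ContDiffWithinAt ℝ n (fun y => η y v) s x) :
    ContDiffWithinAt ℝ n η s x := by
  let b := Module.finBasis ℝ E
  let T : (E [⋀^Fin k]→L[ℝ] ℝ) →ₗ[ℝ] ((Fin k → Fin (Module.finrank ℝ E)) → ℝ) :=
    { toFun := fun ζ j => ζ (fun i => b (j i))
      map_add' := fun _ _ => rfl
      map_smul' := fun _ _ => rfl }
  have hT : LinearMap.ker T = ⊥ := by
    refine LinearMap.ker_eq_bot'.mpr fun ζ hζ => ?_
    have h0 : ζ.toAlternatingMap.toMultilinearMap = 0 :=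
      Module.Basis.ext_multilinear (fun _ => b) fun j => congrFun hζ j
    ext v
    exact congrArg (fun m : MultilinearMap ℝ (fun _ : Fin k => E) ℝ => m v) h0
  obtain ⟨g, hg⟩ := T.exists_leftInverse_of_injective hT
  have hfact : η = fun y => LinearMap.toContinuousLinearMap g (T (η y)) := by
    funext y
    exact (congrArg (fun l => l (η y)) hg).symm
  rw [hfact]
  exact (LinearMap.toContinuousLinearMap g).contDiff.comp_contDiffWithinAt
    (contDiffWithinAt_pi.mpr fun j => hη _)

/-- Induction on `k`: currying is continuous linear, so the first argument can be fed in as a smooth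
family of linear maps applied to a smooth vector. -/
theorem ContDiffWithinAt.multilinear_apply {k : ℕ} {n : WithTop ℕ∞}
    {m : X → ContinuousMultilinearMap ℝ (fun _ : Fin k => E') ℝ} {v : Fin k → X → E'}
    {s : Set X} {x : X}
    (hm : ContDiffWithinAt ℝ n m s x) (hv : ∀ i, ContDiffWithinAt ℝ n (v i) s x) :
    ContDiffWithinAt ℝ n (fun y => m y (fun i => v i y)) s x := by
  induction k with
  | zero =>
    have h0 : (fun y => m y (fun i => v i y)) =
        fun y => ContinuousMultilinearMap.apply ℝ (fun _ : Fin 0 => E') ℝ 0 (m y) := by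
      funext y
      exact congrArg (m y) (Subsingleton.elim _ _)
    rw [h0]
    exact (ContinuousLinearMap.contDiff _).comp_contDiffWithinAt hm
  | succ k ih =>
    have h1 : (fun y => m y (fun i => v i y)) =
        fun y => (m y).curryLeft (v 0 y) (fun i => v i.succ y) := by
      funext y
      rw [ContinuousMultilinearMap.curryLeft_apply]
      congr 1
      funext i
      refine Fin.cases ?_ (fun j => ?_) i <;> simp
    rw [h1]
    refine ih (m := fun y => (m y).curryLeft (v 0 y)) ?_ fun i => hv i.succ
    have hc : ContDiff ℝ n (fun l : ContinuousMultilinearMap ℝ (fun _ : Fin (k + 1) => E') ℝ =>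
        l.curryLeft) := by
      let e : ContinuousMultilinearMap ℝ (fun _ : Fin (k + 1) => E') ℝ →L[ℝ]
          (E' →L[ℝ] ContinuousMultilinearMap ℝ (fun _ : Fin k => E') ℝ) :=
        (continuousMultilinearCurryLeftEquiv ℝ (fun _ : Fin (k + 1) => E')
          ℝ).toContinuousLinearEquiv.toContinuousLinearMap
      exact ContinuousLinearMap.contDiff (𝕜 := ℝ)
        (E := ContinuousMultilinearMap ℝ (fun _ : Fin (k + 1) => E') ℝ)
        (F := E' →L[ℝ] ContinuousMultilinearMap ℝ (fun _ : Fin k => E') ℝ) e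
    exact ContDiffWithinAt.clm_apply (hc.comp_contDiffWithinAt hm) (hv 0)

theorem ContDiffWithinAt.alternating_apply {k : ℕ} {n : WithTop ℕ∞}
    {η : X → E' [⋀^Fin k]→L[ℝ] ℝ} {v : Fin k → X → E'} {s : Set X} {x : X}
    (hη : ContDiffWithinAt ℝ n η s x) (hv : ∀ i, ContDiffWithinAt ℝ n (v i) s x) :
    ContDiffWithinAt ℝ n (fun y => η y (fun i => v i y)) s x := by
  have hc : ContDiff ℝ n (fun l : E' [⋀^Fin k]→L[ℝ] ℝ => l.toContinuousMultilinearMap) :=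
    (ContinuousAlternatingMap.toContinuousMultilinearMapCLM ℝ
      (𝕜 := ℝ) (E := E') (F := ℝ) (ι := Fin k)).contDiff
  exact ContDiffWithinAt.multilinear_apply (hc.comp_contDiffWithinAt hη) hv

theorem ContDiffWithinAt.alternating_compContinuousLinearMap {k : ℕ} {n : WithTop ℕ∞}
    {η : X → E' [⋀^Fin k]→L[ℝ] ℝ} {g : X → E →L[ℝ] E'} {s : Set X} {x : X}
    (hη : ContDiffWithinAt ℝ n η s x) (hg : ContDiffWithinAt ℝ n g s x) :
    ContDiffWithinAt ℝ n (fun y => (η y).compContinuousLinearMap (g y)) s x :=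
  contDiffWithinAt_alternating_of_apply fun _ =>
    hη.alternating_apply fun _ => hg.clm_apply contDiffWithinAt_const

end AlternatingComponents

/-! ### Exterior calculus on manifolds: pull-back, `d`, naturality -/

namespace DForm

section Calculus

variable {E : Type*} [NormedAddCommGroup E] [NormedSpace ℝ E]
  {H : Type*} [TopologicalSpace H] {I : ModelWithCorners ℝ E H}
  {M : Type*} [TopologicalSpace M] [ChartedSpace H M]
  {E' : Type*} [NormedAddCommGroup E'] [NormedSpace ℝ E']
  {H' : Type*} [TopologicalSpace H'] {J : ModelWithCorners ℝ E' H'}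
  {N : Type*} [TopologicalSpace N] [ChartedSpace H' N]
  {E'' : Type*} [NormedAddCommGroup E''] [NormedSpace ℝ E'']
  {H'' : Type*} [TopologicalSpace H''] {K : ModelWithCorners ℝ E'' H''}
  {O : Type*} [TopologicalSpace O] [ChartedSpace H'' O]
  {k : ℕ}

theorem minSmoothness_two_le_infty : minSmoothness ℝ 2 ≤ (∞ : WithTop ℕ∞) := by
  rw [minSmoothness_of_isRCLikeNormedField]
  exact ENat.LEInfty.out

theorem inChart_apply (η : DForm I M k) (x₀ : M) (y : E) (v : Fin k → E) :
    η.inChart x₀ y v = η ((extChartAt I x₀).symm y)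
      (fun i => mfderivWithin 𝓘(ℝ, E) I (extChartAt I x₀).symm (Set.range I) y (v i)) := rfl

theorem pullback_apply (g : M → N) (η : DForm J N k) (x : M) (v : Fin k → TangentSpace I x) :
    DForm.pullback (I := I) g η x v = η (g x) (fun i => mfderiv I J g x (v i)) := rfl

/-- All tangent spaces are the model space `E`, so the base point can be rewritten without
transporting the vectors. -/
theorem apply_congr (η : DForm I M k) {x y : M} (h : x = y) (v : Fin k → E) :
    (η x : E [⋀^Fin k]→L[ℝ] ℝ) v = (η y : E [⋀^Fin k]→L[ℝ] ℝ) v := by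
  subst h; rfl

theorem apply_eq_inChart [IsManifold I 1 M] (η : DForm I M k) {x₀ x : M}
    (hx : x ∈ (extChartAt I x₀).source) (v : Fin k → TangentSpace I x) :
    η x v = η.inChart x₀ (extChartAt I x₀ x)
      (fun i => mfderiv I 𝓘(ℝ, E) (extChartAt I x₀) x (v i)) := by
  have h1 := mfderivWithin_extChartAt_symm_comp_mfderiv_extChartAt' (I := I) hx
  have h2 : ∀ w : TangentSpace I x,
      mfderivWithin 𝓘(ℝ, E) I (extChartAt I x₀).symm (Set.range I) (extChartAt I x₀ x)
        (mfderiv I 𝓘(ℝ, E) (extChartAt I x₀) x w) = w := fun w => congrArg (fun l => l w) h1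
  refine (η.apply_congr ((extChartAt I x₀).left_inv hx).symm v).trans ?_
  exact congrArg (η ((extChartAt I x₀).symm (extChartAt I x₀ x)) :
    E [⋀^Fin k]→L[ℝ] ℝ) (funext fun i => (h2 (v i)).symm)

theorem contDiffAt_inChart [I.Boundaryless] {η : DForm I M k} (hη : η.IsSmooth) {x₀ : M} {y : E}
    (hy : y ∈ (extChartAt I x₀).target) : ContDiffAt ℝ ∞ (η.inChart x₀) y :=
  (hη x₀).contDiffAt (extChartAt_target_mem_nhds' hy)

theorem contMDiffAt_extChartAt_symm [I.Boundaryless] [IsManifold I ∞ M] {x₀ : M} {y : E}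
    (hy : y ∈ (extChartAt I x₀).target) :
    ContMDiffAt 𝓘(ℝ, E) I ∞ (extChartAt I x₀).symm y :=
  (contMDiffOn_extChartAt_symm x₀).contMDiffAt (extChartAt_target_mem_nhds' hy)

theorem contDiffAt_inCharts [I.Boundaryless] [IsManifold I ∞ M] [IsManifold J ∞ N]
    {g : M → N} {x₀ : M} {y : E} (hy : y ∈ (extChartAt I x₀).target) {z₀ : N}
    (hg : ContMDiffAt I J ∞ g ((extChartAt I x₀).symm y))
    (hz : g ((extChartAt I x₀).symm y) ∈ (extChartAt J z₀).source) :
    ContDiffAt ℝ ∞ (extChartAt J z₀ ∘ g ∘ (extChartAt I x₀).symm) y := by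
  rw [extChartAt_source] at hz
  exact ((contMDiffAt_extChartAt' hz).comp y
    (hg.comp y (contMDiffAt_extChartAt_symm hy))).contDiffAt

/-- The chain rule. The chart at `z₀` need only contain the image point, so one chart serves for all
nearby points. -/
theorem pullback_inChart [I.Boundaryless] [IsManifold I 1 M] [IsManifold J 1 N]
    {g : M → N} (η : DForm J N k) {x₀ : M} {y : E} (hy : y ∈ (extChartAt I x₀).target) {z₀ : N}
    (hg : MDifferentiableAt I J g ((extChartAt I x₀).symm y))
    (hz : g ((extChartAt I x₀).symm y) ∈ (extChartAt J z₀).source) :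
    (DForm.pullback (I := I) g η).inChart x₀ y =
      (η.inChart z₀ ((extChartAt J z₀ ∘ g ∘ (extChartAt I x₀).symm) y)).compContinuousLinearMap
        (fderiv ℝ (extChartAt J z₀ ∘ g ∘ (extChartAt I x₀).symm) y) := by
  ext v
  rw [inChart_apply, pullback_apply, apply_eq_inChart η hz,
    ContinuousAlternatingMap.compContinuousLinearMap_apply]
  congr 1
  funext i
  have hz' := hz
  rw [extChartAt_source] at hz'
  have h1 : MDifferentiableAt 𝓘(ℝ, E) I (extChartAt I x₀).symm y := by
    have := mdifferentiableWithinAt_extChartAt_symm (I := I) hy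
    rwa [I.range_eq_univ, mdifferentiableWithinAt_univ] at this
  rw [← mfderiv_eq_fderiv,
    mfderiv_comp y (mdifferentiableAt_extChartAt hz') (hg.comp y h1), mfderiv_comp y hg h1,
    I.range_eq_univ, mfderivWithin_univ]
  rfl

theorem eventually_pullback_inChart [I.Boundaryless] [IsManifold I ∞ M] [IsManifold J ∞ N]
    {g : M → N} (η : DForm J N k) {x₀ : M} {y : E} (hy : y ∈ (extChartAt I x₀).target) {z₀ : N}
    (hg : ContMDiffAt I J ∞ g ((extChartAt I x₀).symm y))
    (hz : g ((extChartAt I x₀).symm y) ∈ (extChartAt J z₀).source) :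
    (DForm.pullback (I := I) g η).inChart x₀ =ᶠ[𝓝 y] fun y' =>
      (η.inChart z₀ ((extChartAt J z₀ ∘ g ∘ (extChartAt I x₀).symm) y')).compContinuousLinearMap
        (fderiv ℝ (extChartAt J z₀ ∘ g ∘ (extChartAt I x₀).symm) y') := by
  have : IsManifold I 1 M := IsManifold.of_le (n := ∞) (by simp)
  have : IsManifold J 1 N := IsManifold.of_le (n := ∞) (by simp)
  have hc := (contMDiffAt_extChartAt_symm (I := I) hy).continuousAt
  -- Smoothness of order `∞` at a point need not hold on one neighbourhood, but `C^1` does, and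
  -- differentiability nearby is all that is needed.
  have h1 : ∀ᶠ w in 𝓝 ((extChartAt I x₀).symm y), ContMDiffAt I J 1 g w :=
    contMDiffAt_iff_contMDiffAt_nhds (by simp) |>.mp (hg.of_le (by exact_mod_cast le_top))
  have h2 : ∀ᶠ w in 𝓝 ((extChartAt I x₀).symm y), g w ∈ (extChartAt J z₀).source :=
    hg.continuousAt ((isOpen_extChartAt_source z₀).mem_nhds hz)
  filter_upwards [extChartAt_target_mem_nhds' hy, hc.eventually h1, hc.eventually h2]
    with y' hy' h1' h2'
  exact pullback_inChart η hy' (h1'.mdifferentiableAt (by simp)) h2'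

theorem contDiffAt_pullback_inChart [FiniteDimensional ℝ E] [I.Boundaryless] [J.Boundaryless]
    [IsManifold I ∞ M] [IsManifold J ∞ N]
    {g : M → N} {η : DForm J N k} (hη : η.IsSmooth) {x₀ : M} {y : E}
    (hy : y ∈ (extChartAt I x₀).target) (hg : ContMDiffAt I J ∞ g ((extChartAt I x₀).symm y)) :
    ContDiffAt ℝ ∞ ((DForm.pullback (I := I) g η).inChart x₀) y := by
  have hz := mem_extChartAt_source (I := J) (g ((extChartAt I x₀).symm y))
  have hh := contDiffAt_inCharts hy hg hz
  refine ContDiffAt.congr_of_eventuallyEq ?_ (eventually_pullback_inChart η hy hg hz)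
  refine ContDiffWithinAt.alternating_compContinuousLinearMap ?_ (hh.fderiv_right (by simp))
  exact (contDiffAt_inChart hη ((extChartAt J _).map_source hz)).comp y hh

theorem IsSmooth.pullback [FiniteDimensional ℝ E] [I.Boundaryless] [J.Boundaryless]
    [IsManifold I ∞ M] [IsManifold J ∞ N] {g : M → N} {η : DForm J N k} (hη : η.IsSmooth)
    (hg : ContMDiff I J ∞ g) : (DForm.pullback (I := I) g η).IsSmooth := fun _ _ hy =>
  (contDiffAt_pullback_inChart hη hy (hg _)).contDiffWithinAt

theorem d_apply [I.Boundaryless] (η : DForm I M k) (x : M) :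
    η.d x = (extDeriv (η.inChart x) (extChartAt I x x)).compContinuousLinearMap
      (mfderiv I 𝓘(ℝ, E) (extChartAt I x) x) := by
  rw [DForm.d, I.range_eq_univ, extDerivWithin_univ]

/-- In the charts at `x` and `g x` this is naturality of `extDeriv` on vector spaces. Only
smoothness of `g` at `x` is required, so the result applies to inverse charts. -/
theorem d_pullback [I.Boundaryless] [J.Boundaryless]
    [IsManifold I ∞ M] [IsManifold J ∞ N] {g : M → N} {η : DForm J N k} (hη : η.IsSmooth) {x : M}
    (hg : ContMDiffAt I J ∞ g x) :
    (DForm.pullback (I := I) g η).d x = DForm.pullback (I := I) g η.d x := by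
  have : IsManifold I 1 M := IsManifold.of_le (n := ∞) (by simp)
  have : IsManifold J 1 N := IsManifold.of_le (n := ∞) (by simp)
  have hx := mem_extChartAt_source (I := I) x
  have hy := (extChartAt I x).map_source hx
  have hinv := (extChartAt I x).left_inv hx
  have hz : g ((extChartAt I x).symm (extChartAt I x x)) ∈ (extChartAt J (g x)).source := by
    rw [hinv]; exact mem_extChartAt_source _
  have hg' : ContMDiffAt I J ∞ g ((extChartAt I x).symm (extChartAt I x x)) := by rwa [hinv]
  have hh := contDiffAt_inCharts hy hg' hz
  have hpt : (extChartAt J (g x) ∘ g ∘ (extChartAt I x).symm) (extChartAt I x x) =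
      extChartAt J (g x) (g x) := by simp only [Function.comp_apply, hinv]
  have hsm : ContDiffAt ℝ ∞ (η.inChart (g x))
      ((extChartAt J (g x) ∘ g ∘ (extChartAt I x).symm) (extChartAt I x x)) := by
    rw [hpt]
    exact contDiffAt_inChart hη ((extChartAt J _).map_source (mem_extChartAt_source _))
  -- The coordinate expression of `g` after the chart at `x` equals the chart at `g x` after `g`,
  -- near `x`; both sides are differentiated.
  have hD : ∀ v : TangentSpace I x,
      fderiv ℝ (extChartAt J (g x) ∘ g ∘ (extChartAt I x).symm) (extChartAt I x x)
        (mfderiv I 𝓘(ℝ, E) (extChartAt I x) x v) =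
      mfderiv J 𝓘(ℝ, E') (extChartAt J (g x)) (g x) (mfderiv I J g x v) := by
    intro v
    have e1 : (extChartAt J (g x) ∘ g ∘ (extChartAt I x).symm) ∘ extChartAt I x =ᶠ[𝓝 x]
        extChartAt J (g x) ∘ g := by
      filter_upwards [(isOpen_extChartAt_source x).mem_nhds hx] with x' hx'
      simp only [Function.comp_apply, (extChartAt I x).left_inv hx']
    have e2 := e1.mfderiv_eq (I := I) (I' := 𝓘(ℝ, E'))
    rw [mfderiv_comp x (hh.contMDiffAt.mdifferentiableAt (by simp))
        (mdifferentiableAt_extChartAt (mem_chart_source H x)),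
      mfderiv_comp x (mdifferentiableAt_extChartAt (mem_chart_source H' (g x)))
        (hg.mdifferentiableAt (by simp)), mfderiv_eq_fderiv] at e2
    exact congrArg (fun l : E →L[ℝ] E' => l v) e2
  ext v
  rw [d_apply, (eventually_pullback_inChart η hy hg' hz).extDeriv_eq,
    extDeriv_pullback (hsm.differentiableAt (by simp)) hh minSmoothness_two_le_infty, hpt, pullback_apply, d_apply]
  exact congrArg (extDeriv (η.inChart (g x)) (extChartAt J (g x) (g x)))
    (funext fun i => hD (v i))

theorem inChart_modelSpace (ζ : DForm 𝓘(ℝ, E) E k) (x₀ : E) : ζ.inChart x₀ = ζ := by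
  funext y
  ext v
  rw [inChart_apply]
  have h1 : mfderivWithin 𝓘(ℝ, E) 𝓘(ℝ, E) (extChartAt 𝓘(ℝ, E) x₀).symm (Set.range 𝓘(ℝ, E)) y =
      ContinuousLinearMap.id ℝ E := by
    have h2 : ⇑(extChartAt 𝓘(ℝ, E) x₀).symm = id := by
      rw [extChartAt_model_space_eq_id]; rfl
    rw [h2, 𝓘(ℝ, E).range_eq_univ, mfderivWithin_univ, mfderiv_id]
    rfl
  rw [h1]
  exact ζ.apply_congr (by rw [extChartAt_model_space_eq_id]; rfl) v

theorem d_modelSpace (ζ : DForm 𝓘(ℝ, E) E k) (x : E) : ζ.d x = extDeriv ζ x := by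
  rw [d_apply, inChart_modelSpace]
  have h1 : mfderiv 𝓘(ℝ, E) 𝓘(ℝ, E) (extChartAt 𝓘(ℝ, E) x) x = ContinuousLinearMap.id ℝ E := by
    have h2 : ⇑(extChartAt 𝓘(ℝ, E) x) = id := by
      rw [extChartAt_model_space_eq_id]; rfl
    rw [h2, mfderiv_id]
    rfl
  rw [h1]
  rfl

theorem inChart_eq_pullback [I.Boundaryless] (η : DForm I M k) (x₀ : M) :
    η.inChart x₀ = DForm.pullback (I := 𝓘(ℝ, E)) (extChartAt I x₀).symm η := by
  funext y
  rw [DForm.inChart, DForm.pullback, I.range_eq_univ, mfderivWithin_univ]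
  rfl

/-- Chart independence of `d`, whose definition uses a different chart at every point. It is
naturality for the inverse chart, which is a map out of a vector space. -/
theorem inChart_d [I.Boundaryless] [IsManifold I ∞ M] {η : DForm I M k} (hη : η.IsSmooth)
    {x₀ : M} {y : E} (hy : y ∈ (extChartAt I x₀).target) :
    η.d.inChart x₀ y = extDeriv (η.inChart x₀) y := by
  rw [inChart_eq_pullback, inChart_eq_pullback, ← d_pullback hη (contMDiffAt_extChartAt_symm hy)]
  exact d_modelSpace _ y

theorem eventually_inChart_d [I.Boundaryless] [IsManifold I ∞ M] {η : DForm I M k}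
    (hη : η.IsSmooth) {x₀ : M} {y : E} (hy : y ∈ (extChartAt I x₀).target) :
    η.d.inChart x₀ =ᶠ[𝓝 y] extDeriv (η.inChart x₀) := by
  filter_upwards [extChartAt_target_mem_nhds' hy] with y' hy'
  exact inChart_d hη hy'

theorem IsSmooth.d [I.Boundaryless] [IsManifold I ∞ M] {η : DForm I M k} (hη : η.IsSmooth) :
    η.d.IsSmooth := by
  intro x₀ y hy
  refine (ContDiffAt.congr_of_eventuallyEq ?_ (eventually_inChart_d hη hy)).contDiffWithinAt
  have hc : ContDiff ℝ ∞ (fun l : E →L[ℝ] E [⋀^Fin k]→L[ℝ] ℝ =>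
      ContinuousAlternatingMap.alternatizeUncurryFin l) :=
    ContinuousLinearMap.contDiff (𝕜 := ℝ) (E := E →L[ℝ] E [⋀^Fin k]→L[ℝ] ℝ)
      (F := E [⋀^Fin (k + 1)]→L[ℝ] ℝ)
      (ContinuousAlternatingMap.alternatizeUncurryFinCLM ℝ E ℝ)
  exact hc.contDiffAt.comp y (
(contDiffAt_inChart hη hy).fderiv_right (m := ∞) (by simp))

/-- The coefficient along a constant vector is the function on `TM` evaluated on the tangent map of
the inverse chart. -/
theorem isSmooth_oneForm [FiniteDimensional ℝ E] [I.Boundaryless] [IsManifold I ∞ M]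
    {a : ∀ x : M, TangentSpace I x →L[ℝ] ℝ}
    (ha : ContMDiff I.tangent 𝓘(ℝ) ∞ (fun X : TangentBundle I M => a X.proj X.snd)) :
    (oneForm a).IsSmooth := by
  intro x₀
  have : IsManifold I 1 M := IsManifold.of_le (n := ∞) (by simp)
  have ho := isOpen_extChartAt_target (I := I) x₀
  intro y hy
  refine contDiffWithinAt_alternating_of_apply fun v => ?_
  have hsec : ContMDiff 𝓘(ℝ, E) 𝓘(ℝ, E).tangent ∞
      (fun y : E => (⟨y, v 0⟩ : TangentBundle 𝓘(ℝ, E) E)) :=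
    contMDiff_vectorSpace_iff_contDiff.mpr contDiff_const
  have htan := (contMDiffOn_extChartAt_symm (I := I) (n := ∞) x₀).contMDiffOn_tangentMapWithin
    (m := ∞) (by simp) ho.uniqueMDiffOn
  have hcomp := (ha.comp_contMDiffOn (htan.comp hsec.contMDiffOn (fun z hz => hz))).contDiffOn
  refine (hcomp.congr fun z hz => ?_) y hy
  simp only [Function.comp_apply, tangentMapWithin]
  rw [mfderivWithin_of_isOpen ho hz, inChart_apply, I.range_eq_univ, mfderivWithin_univ]
  rfl

theorem d_d [I.Boundaryless] [IsManifold I ∞ M] {η : DForm I M k} (hη : η.IsSmooth) :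
    η.d.d = 0 := by
  funext x
  have hy := (extChartAt I x).map_source (mem_extChartAt_source (I := I) x)
  rw [d_apply, (eventually_inChart_d hη hy).extDeriv_eq,
    extDeriv_extDeriv_apply (contDiffAt_inChart hη hy) minSmoothness_two_le_infty]
  rfl

theorem inChart_add (η ζ : DForm I M k) (x₀ : M) :
    (η + ζ).inChart x₀ = η.inChart x₀ + ζ.inChart x₀ := rfl

theorem IsSmooth.add {η ζ : DForm I M k} (hη : η.IsSmooth) (hζ : ζ.IsSmooth) :
    (η + ζ).IsSmooth := fun x₀ => (hη x₀).add (hζ x₀)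

theorem d_add [I.Boundaryless] {η ζ : DForm I M k} (hη : η.IsSmooth) (hζ : ζ.IsSmooth) :
    (η + ζ).d = η.d + ζ.d := by
  funext x
  have hy := (extChartAt I x).map_source (mem_extChartAt_source (I := I) x)
  have h1 : (η + ζ).d x = _ := d_apply _ x
  rw [h1, inChart_add, extDeriv_add ((contDiffAt_inChart hη hy).differentiableAt (by simp))
    ((contDiffAt_inChart hζ hy).differentiableAt (by simp))]
  have h2 : (η.d + ζ.d) x = η.d x + ζ.d x := rfl
  rw [h2, d_apply η, d_apply ζ]
  rfl

theorem pullback_add (g : M → N) (η ζ : DForm J N k) :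
    DForm.pullback (I := I) g (η + ζ) = DForm.pullback g η + DForm.pullback g ζ := rfl

theorem pullback_pullback {g : M → N} {h : N → O} (η : DForm K O k)
    (hg : MDifferentiable I J g) (hh : MDifferentiable J K h) :
    DForm.pullback (I := I) g (DForm.pullback (I := J) h η) =
      DForm.pullback (I := I) (fun x => h (g x)) η := by
  funext x
  ext v
  have h1 : mfderiv I K (fun x => h (g x)) x = _ := mfderiv_comp x (hh (g x)) (hg x)
  rw [pullback_apply, pullback_apply, pullback_apply, h1]
  rfl

end Calculus

end DForm

/-! ### Smooth maps into pull-back bundles and fibre products -/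

section PullbackBundles

variable {EP : Type*} [NormedAddCommGroup EP] [NormedSpace ℝ EP]
  {EQ : Type*} [NormedAddCommGroup EQ] [NormedSpace ℝ EQ]
  {P : Type*} [TopologicalSpace P] [ChartedSpace EP P]
  {Q : Type*} [TopologicalSpace Q] [ChartedSpace EQ Q]
  {F : Type*} [NormedAddCommGroup F] [NormedSpace ℝ F]
  {V : Q → Type*} [∀ q, AddCommGroup (V q)] [∀ q, Module ℝ (V q)] [∀ q, TopologicalSpace (V q)]
  [TopologicalSpace (TotalSpace F V)] [FiberBundle F V]
  {EN : Type*} [NormedAddCommGroup EN] [NormedSpace ℝ EN]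
  {HN : Type*} [TopologicalSpace HN] {IN : ModelWithCorners ℝ EN HN}
  {N : Type*} [TopologicalSpace N] [ChartedSpace HN N]

/-- The fibre coordinate of the pull-back bundle is that of the original bundle at the lifted point.
-/
theorem contMDiffAt_pullbackBundle_iff (ε : C^∞⟮𝓘(ℝ, EP), P; 𝓘(ℝ, EQ), Q⟯)
    {g : N → TotalSpace F (ε *ᵖ V)} {x : N} :
    ContMDiffAt IN (𝓘(ℝ, EP).prod 𝓘(ℝ, F)) ∞ g x ↔
      ContMDiffAt IN 𝓘(ℝ, EP) ∞ (fun y => (g y).proj) x ∧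
      ContMDiffAt IN (𝓘(ℝ, EQ).prod 𝓘(ℝ, F)) ∞ (fun y => Pullback.lift ε (g y)) x := by
  rw [contMDiffAt_totalSpace, contMDiffAt_totalSpace]
  constructor
  · rintro ⟨h1, h2⟩
    exact ⟨h1, ε.contMDiff.contMDiffAt.comp x h1, h2⟩
  · rintro ⟨h1, -, h2⟩
    exact ⟨h1, h2⟩

end PullbackBundles

section FibreProducts

variable {EP : Type*} [NormedAddCommGroup EP] [NormedSpace ℝ EP]
  {EQ : Type*} [NormedAddCommGroup EQ] [NormedSpace ℝ EQ]
  {P : Type*} [TopologicalSpace P] [ChartedSpace EP P]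
  {Q : Type*} [TopologicalSpace Q] [ChartedSpace EQ Q] [IsManifold 𝓘(ℝ, EQ) ∞ Q]
  {ε : C^∞⟮𝓘(ℝ, EP), P; 𝓘(ℝ, EQ), Q⟯}
  {EN : Type*} [NormedAddCommGroup EN] [NormedSpace ℝ EN]
  {HN : Type*} [TopologicalSpace HN] {IN : ModelWithCorners ℝ EN HN}
  {N : Type*} [TopologicalSpace N] [ChartedSpace HN N]

theorem contMDiffAt_TP_iff {g : N → TP ε} {x : N} :
    ContMDiffAt IN (TPModel EP EQ) ∞ g x ↔
      ContMDiffAt IN 𝓘(ℝ, EP) ∞ (fun y => tau₂ (g y)) x ∧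
      ContMDiffAt IN 𝓘(ℝ, EQ).tangent ∞ (fun y => tau₁ (g y)) x :=
  contMDiffAt_pullbackBundle_iff ε

theorem contMDiffAt_TPDual_iff {g : N → TPDual ε} {x : N} :
    ContMDiffAt IN (TPDualModel EP EQ) ∞ g x ↔
      ContMDiffAt IN 𝓘(ℝ, EP) ∞ (fun y => pi₂ (g y)) x ∧
      ContMDiffAt IN (𝓘(ℝ, EQ).prod 𝓘(ℝ, EQ →L[ℝ] ℝ)) ∞ (fun y => pi₁ (g y)) x :=
  contMDiffAt_pullbackBundle_iff ε

theorem contMDiff_tau₁ :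
    ContMDiff (TPModel EP EQ) 𝓘(ℝ, EQ).tangent ∞ (tau₁ : TP ε → TangentBundle 𝓘(ℝ, EQ) Q) :=
  fun _ => (contMDiffAt_TP_iff.mp contMDiffAt_id).2

theorem contMDiff_tau₂ : ContMDiff (TPModel EP EQ) 𝓘(ℝ, EP) ∞ (tau₂ : TP ε → P) :=
  fun _ => (contMDiffAt_TP_iff.mp contMDiffAt_id).1

theorem contMDiff_pi₁ :
    ContMDiff (TPDualModel EP EQ) (𝓘(ℝ, EQ).prod 𝓘(ℝ, EQ →L[ℝ] ℝ)) ∞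
      (pi₁ : TPDual ε → Cotangent EQ Q) :=
  fun _ => (contMDiffAt_TPDual_iff.mp contMDiffAt_id).2

theorem contMDiff_pi₂ : ContMDiff (TPDualModel EP EQ) 𝓘(ℝ, EP) ∞ (pi₂ : TPDual ε → P) :=
  fun _ => (contMDiffAt_TPDual_iff.mp contMDiffAt_id).1

theorem contMDiff_tangentFiber (q : Q) :
    ContMDiff 𝓘(ℝ, EQ) 𝓘(ℝ, EQ).tangent ∞
      (fun v : EQ => (⟨q, v⟩ : TangentBundle 𝓘(ℝ, EQ) Q)) := by
  intro v
  refine contMDiffAt_totalSpace.mpr ⟨contMDiffAt_const, ?_⟩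
  have hq : q ∈ (trivializationAt EQ (TangentSpace 𝓘(ℝ, EQ) : Q → Type _) q).baseSet :=
    mem_baseSet_trivializationAt _ _ _
  have h1 : (fun v : EQ => (trivializationAt EQ (TangentSpace 𝓘(ℝ, EQ) : Q → Type _) q
      (⟨q, v⟩ : TangentBundle 𝓘(ℝ, EQ) Q)).2) = fun v => v := by
    funext v
    exact tangentCoordChange_self (I := 𝓘(ℝ, EQ)) (mem_extChartAt_source (I := 𝓘(ℝ, EQ)) q)
  exact (contMDiff_id.congr fun v => congrFun h1 v).contMDiffAt

theorem contMDiff_TPFiber (p : P) :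
    ContMDiff 𝓘(ℝ, EQ) (TPModel EP EQ) ∞ (fun v : EQ => (⟨p, v⟩ : TP ε)) := fun v =>
  contMDiffAt_TP_iff.mpr ⟨contMDiffAt_const, contMDiff_tangentFiber (ε p) v⟩

theorem contMDiffAt_trivializationAt_symm (p₀ : P) (p : P) (t : EQ)
    (hp : ε p ∈ (trivializationAt EQ (TangentSpace 𝓘(ℝ, EQ) : Q → Type _) (ε p₀)).baseSet) :
    ContMDiffAt (TPModel EP EQ) (TPModel EP EQ) ∞ (fun x : P × EQ => (⟨x.1,
      (trivializationAt EQ (TangentSpace 𝓘(ℝ, EQ) : Q → Type _) (ε p₀)).symm (ε x.1) x.2⟩ : TP ε))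
      (p, t) := by
  set e := trivializationAt EQ (TangentSpace 𝓘(ℝ, EQ) : Q → Type _) (ε p₀) with he
  refine contMDiffAt_TP_iff.mpr ⟨contMDiffAt_fst, ?_⟩
  have h1 : ContMDiffAt (TPModel EP EQ) (𝓘(ℝ, EQ).prod 𝓘(ℝ, EQ)) ∞
      (fun x : P × EQ => (ε x.1, x.2)) (p, t) :=
    (ε.contMDiff.contMDiffAt.comp (p, t) contMDiffAt_fst).prodMk contMDiffAt_snd
  have h2 : (ε p, t) ∈ e.target := e.mem_target.mpr hp
  have h3 := (e.contMDiffOn_symm (IB := 𝓘(ℝ, EQ)) (n := ∞)).contMDiffAt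
    (e.open_target.mem_nhds h2)
  refine (h3.comp (p, t) h1).congr_of_eventuallyEq ?_
  filter_upwards [h1.continuousAt (e.open_target.mem_nhds h2)] with x hx
  exact e.mk_symm (e.mem_target.mp hx) x.2

end FibreProducts

/-! ### Smoothness of the fibre derivative and of the canonical 1-form -/

section Legendre

variable {EP : Type*} [NormedAddCommGroup EP] [NormedSpace ℝ EP]
  {EQ : Type*} [NormedAddCommGroup EQ] [NormedSpace ℝ EQ]
  {P : Type*} [TopologicalSpace P] [ChartedSpace EP P] [IsManifold 𝓘(ℝ, EP) ∞ P]
  {Q : Type*} [TopologicalSpace Q] [ChartedSpace EQ Q] [IsManifold 𝓘(ℝ, EQ) ∞ Q]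
  {ε : C^∞⟮𝓘(ℝ, EP), P; 𝓘(ℝ, EQ), Q⟯}

theorem contDiff_fiber {L : TP ε → ℝ} (hL : ContMDiff (TPModel EP EQ) 𝓘(ℝ) ∞ L) (p : P) :
    ContDiff ℝ ∞ (fun v : EQ => L ⟨p, v⟩) :=
  (hL.comp (contMDiff_TPFiber p)).contDiff

theorem contDiff_fiberCovector {L : TP ε → ℝ} (hL : ContMDiff (TPModel EP EQ) 𝓘(ℝ) ∞ L) (p : P) :
    ContDiff ℝ ∞ (fun v : EQ => (show EQ →L[ℝ] ℝ from fiberCovector L (⟨p, v⟩ : TP ε))) :=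
  (contDiff_fiber hL p).fderiv_right (m := ∞) (by simp)

/-- In a trivialization of `TQ` the fibre derivative is a partial derivative of a smooth function of
`(s, t)`, taken at the smoothly moving point `t = g s`. -/
theorem contMDiff_fiberCovector {L : TP ε → ℝ} (hL : ContMDiff (TPModel EP EQ) 𝓘(ℝ) ∞ L) :
    ContMDiff (TPModel EP EQ) (𝓘(ℝ, EQ).prod 𝓘(ℝ, EQ →L[ℝ] ℝ)) ∞
      (fun s : TP ε => (⟨ε s.proj, fiberCovector L s⟩ : Cotangent EQ Q)) := by
  intro s₀
  refine (contMDiffAt_hom_bundle _).mpr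
    ⟨ε.contMDiff.contMDiffAt.comp s₀ contMDiff_tau₂.contMDiffAt, ?_⟩
  set e := trivializationAt EQ (TangentSpace 𝓘(ℝ, EQ) : Q → Type _) (ε s₀.proj) with he
  have hp₀ : ε s₀.proj ∈ e.baseSet := mem_baseSet_trivializationAt _ _ _
  let g : TP ε → EQ := fun s => (e (tau₁ s)).2
  have hg : ContMDiffAt (TPModel EP EQ) 𝓘(ℝ, EQ) ∞ g s₀ :=
    (contMDiffAt_totalSpace.mp (contMDiff_tau₁ s₀)).2
  let Λ : TP ε → EQ → ℝ := fun s t => L ⟨s.proj, e.symm (ε s.proj) t⟩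
  have hΛ : ContMDiffAt ((TPModel EP EQ).prod 𝓘(ℝ, EQ)) 𝓘(ℝ) ∞ (Function.uncurry Λ)
      (s₀, g s₀) := by
    have h1 := contMDiffAt_trivializationAt_symm (ε := ε) s₀.proj s₀.proj (g s₀) hp₀
    have h2 : ContMDiffAt ((TPModel EP EQ).prod 𝓘(ℝ, EQ)) (TPModel EP EQ) ∞
        (fun x : TP ε × EQ => (tau₂ x.1, x.2)) (s₀, g s₀) :=
      (contMDiff_tau₂.contMDiffAt.comp (s₀, g s₀) contMDiffAt_fst).prodMk contMDiffAt_snd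
    exact ContMDiffAt.comp (g := fun x : P × EQ => L ⟨x.1, e.symm (ε x.1) x.2⟩) (s₀, g s₀)
      (hL.contMDiffAt.comp _ h1) h2
  have hD : ContMDiffAt (TPModel EP EQ) 𝓘(ℝ, EQ →L[ℝ] ℝ) ∞
      (fun s => fderiv ℝ (Λ s) (g s)) s₀ := by
    refine (hΛ.mfderiv Λ g hg (m := ∞) (by simp)).congr_of_eventuallyEq (.of_forall fun s => ?_)
    exact ((congrFun (inTangentCoordinates_model_space g (fun x => Λ x (g x))
      (fun x => fderiv ℝ (Λ x) (g x)) s₀) s).symm.trans (by simp only [mfderiv_eq_fderiv]; rfl))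
  refine hD.congr_of_eventuallyEq ?_
  have hb : ∀ᶠ s in 𝓝 s₀, ε s.proj ∈ e.baseSet :=
    (ε.contMDiff.continuous.comp contMDiff_tau₂.continuous).continuousAt
      (e.open_baseSet.mem_nhds hp₀)
  filter_upwards [hb] with s hs
  have h1 : HasFDerivAt (fun v : EQ => L ⟨s.proj, v⟩) (fiberCovector L s)
      (e.symmL ℝ (ε s.proj) (g s)) := by
    have h2 : e.symmL ℝ (ε s.proj) (g s) = s.snd := by
      rw [e.symmL_apply hs]
      exact e.symm_apply_apply_mk hs s.snd
    rw [h2]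
    exact ((contDiff_fiber hL s.proj).differentiable (by simp) _).hasFDerivAt
  have h3 : fderiv ℝ (Λ s) (g s) = fiberCovector L s ∘L e.symmL ℝ (ε s.proj) := by
    let l : EQ →L[ℝ] EQ := e.symmL ℝ (ε s.proj)
    have h4 : Λ s = (fun v : EQ => L ⟨s.proj, v⟩) ∘ l := by
      funext t
      exact congrArg (fun v => L ⟨s.proj, v⟩) (e.symmL_apply hs t).symm
    rw [h4]
    exact (HasFDerivAt.comp (g s) h1 l.hasFDerivAt).fderiv
  rw [h3, ContinuousLinearMap.inCoordinates_eq hs (Set.mem_univ _)]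
  ext δ
  simp only [ContinuousLinearMap.coe_comp, ContinuousLinearEquiv.coe_coe, Function.comp_apply,
    Trivialization.symm_continuousLinearEquivAt_eq]
  rfl

theorem contMDiff_legendre {L : TP ε → ℝ} (hL : ContMDiff (TPModel EP EQ) 𝓘(ℝ) ∞ L) :
    ContMDiff (TPModel EP EQ) (TPDualModel EP EQ) ∞ (legendre L) := fun s =>
  contMDiffAt_TPDual_iff.mpr ⟨contMDiff_tau₂ s, contMDiff_fiberCovector hL s⟩

theorem contMDiffAt_pairing {EN : Type*} [NormedAddCommGroup EN] [NormedSpace ℝ EN]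
    {HN : Type*} [TopologicalSpace HN] {IN : ModelWithCorners ℝ EN HN}
    {N : Type*} [TopologicalSpace N] [ChartedSpace HN N] {b : N → Q}
    {a : ∀ x : N, TangentSpace 𝓘(ℝ, EQ) (b x) →L[ℝ] ℝ} {X : ∀ x : N, TangentSpace 𝓘(ℝ, EQ) (b x)}
    {x : N}
    (ha : ContMDiffAt IN (𝓘(ℝ, EQ).prod 𝓘(ℝ, EQ →L[ℝ] ℝ)) ∞
      (fun y => (⟨b y, a y⟩ : Cotangent EQ Q)) x)
    (hX : ContMDiffAt IN 𝓘(ℝ, EQ).tangent ∞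
      (fun y => (⟨b y, X y⟩ : TangentBundle 𝓘(ℝ, EQ) Q)) x) :
    ContMDiffAt IN 𝓘(ℝ) ∞ (fun y => a y (X y)) x :=
  (contMDiffAt_totalSpace.mp
    (ContMDiffAt.clm_bundle_apply (E₂ := Bundle.Trivial Q ℝ) (F₂ := ℝ) ha hX)).2

theorem isSmooth_canonicalOneForm [FiniteDimensional ℝ EQ] :
    (canonicalOneForm EQ Q).IsSmooth := by
  refine DForm.isSmooth_oneForm fun X => ?_
  have h1 : ContMDiff (𝓘(ℝ, EQ).prod 𝓘(ℝ, EQ →L[ℝ] ℝ)) 𝓘(ℝ, EQ) ∞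
    (fun b : Cotangent EQ Q => b.proj) := contMDiff_proj _
  exact contMDiffAt_pairing (b := fun Y : TangentBundle (𝓘(ℝ, EQ).prod 𝓘(ℝ, EQ →L[ℝ] ℝ))
      (Cotangent EQ Q) => Y.proj.proj) (a := fun Y => Y.proj.snd)
    (X := fun Y => mfderiv (𝓘(ℝ, EQ).prod 𝓘(ℝ, EQ →L[ℝ] ℝ)) 𝓘(ℝ, EQ)
      (fun b : Cotangent EQ Q => b.proj) Y.proj Y.snd)
    (contMDiff_proj (TangentSpace (𝓘(ℝ, EQ).prod 𝓘(ℝ, EQ →L[ℝ] ℝ)) : Cotangent EQ Q → Type _) X)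
    (h1.contMDiff_tangentMap (m := ∞) (by simp) X)

end Legendre

/-! ### An implicit function theorem and its linear algebra -/

section ImplicitFunctions

theorem contMDiffAt_dual_of_apply {E : Type*} [NormedAddCommGroup E] [NormedSpace ℝ E]
    [FiniteDimensional ℝ E]
    {EN : Type*} [NormedAddCommGroup EN] [NormedSpace ℝ EN]
    {HN : Type*} [TopologicalSpace HN] {IN : ModelWithCorners ℝ EN HN}
    {N : Type*} [TopologicalSpace N] [ChartedSpace HN N] {n : WithTop ℕ∞}
    {G : N → E →L[ℝ] ℝ} {x : N} (hG : ∀ δ : E, ContMDiffAt IN 𝓘(ℝ) n (fun y => G y δ) x) :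
    ContMDiffAt IN 𝓘(ℝ, E →L[ℝ] ℝ) n G x := by
  let b := Module.finBasis ℝ E
  have hfact : G = fun y => ∑ i, G y (b i) • LinearMap.toContinuousLinearMap (b.coord i) := by
    funext y
    ext δ
    conv_lhs => rw [← b.sum_repr δ, map_sum]
    simp [mul_comm]
  rw [hfact]
  exact ContMDiffAt.sum fun i _ => (hG (b i)).smul contMDiffAt_const

/-- Zeros of `G x` are globally unique for `x` near `x₀`, so `t` must agree with the local implicit
function. Hence continuity of `t` need not be assumed. -/
theorem contMDiffAt_of_implicit
    {EN : Type*} [NormedAddCommGroup EN] [NormedSpace ℝ EN] [CompleteSpace EN]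
    {HN : Type*} [TopologicalSpace HN] {IN : ModelWithCorners ℝ EN HN} [IN.Boundaryless]
    {N : Type*} [TopologicalSpace N] [ChartedSpace HN N] [IsManifold IN ∞ N]
    {E : Type*} [NormedAddCommGroup E] [NormedSpace ℝ E] [CompleteSpace E]
    {E' : Type*} [NormedAddCommGroup E'] [NormedSpace ℝ E'] [CompleteSpace E']
    {G : N → E → E'} {t : N → E} {x₀ : N}
    (hG : ContMDiffAt (IN.prod 𝓘(ℝ, E)) 𝓘(ℝ, E') ∞ (Function.uncurry G) (x₀, t x₀))
    (hzero : ∀ᶠ x in 𝓝 x₀, ∀ y : E, G x y = 0 ↔ y = t x)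
    (hinv : (fderiv ℝ (G x₀) (t x₀)).IsInvertible) :
    ContMDiffAt IN 𝓘(ℝ, E) ∞ t x₀ := by
  have hx := mem_extChartAt_source (I := IN) x₀
  have hy := (extChartAt IN x₀).map_source hx
  have hleft : (extChartAt IN x₀).symm (extChartAt IN x₀ x₀) = x₀ := (extChartAt IN x₀).left_inv hx
  let G' : EN × E → E' := fun z => G ((extChartAt IN x₀).symm z.1) z.2
  let u : EN × E := (extChartAt IN x₀ x₀, t x₀)
  have hG' : ContDiffAt ℝ ∞ G' u := by
    have h1 : ContMDiffAt 𝓘(ℝ, EN × E) (IN.prod 𝓘(ℝ, E)) ∞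
        (fun z : EN × E => ((extChartAt IN x₀).symm z.1, z.2)) u :=
      ((DForm.contMDiffAt_extChartAt_symm hy).comp u contDiff_fst.contMDiff.contMDiffAt).prodMk
        contDiff_snd.contMDiff.contMDiffAt
    have h2 : ContMDiffAt (IN.prod 𝓘(ℝ, E)) 𝓘(ℝ, E') ∞ (Function.uncurry G)
        ((extChartAt IN x₀).symm u.1, u.2) := by
      change ContMDiffAt _ _ _ _ ((extChartAt IN x₀).symm (extChartAt IN x₀ x₀), t x₀)
      rw [hleft]; exact hG
    exact (h2.comp u h1).contDiffAt
  have hpart : fderiv ℝ G' u ∘L .inr ℝ EN E = fderiv ℝ (G x₀) (t x₀) := by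
    have h1 : G x₀ = G' ∘ fun y : E => (extChartAt IN x₀ x₀, y) := by
      funext y
      simp only [G', Function.comp_apply, hleft]
    have h2 : HasFDerivAt (fun y : E => (extChartAt IN x₀ x₀, y)) (.inr ℝ EN E) (t x₀) :=
      hasFDerivAt_prodMk_right _ _
    rw [h1]
    exact (HasFDerivAt.comp (t x₀) ((hG'.differentiableAt (by simp)).hasFDerivAt) h2).fderiv.symm
  rw [← hpart] at hinv
  have hn : (∞ : WithTop ℕ∞) ≠ 0 := by simp
  have hτ := hG'.contDiffAt_implicitFunction hn hinv
  have hev := hG'.eventually_apply_implicitFunction hn hinv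
  have hu : G' u = 0 := by
    change G ((extChartAt IN x₀).symm (extChartAt IN x₀ x₀)) (t x₀) = 0
    rw [hleft]
    exact (hzero.self_of_nhds _).mpr rfl
  rw [hu] at hev
  refine (hτ.contMDiffAt.comp x₀ (contMDiffAt_extChartAt (n := ∞))).congr_of_eventuallyEq ?_
  have hc : ContinuousAt (extChartAt IN x₀) x₀ := continuousAt_extChartAt x₀
  filter_upwards [hzero, hc.eventually hev, (isOpen_extChartAt_source x₀).mem_nhds hx]
    with x h1 h2 h3
  refine ((h1 _).mp ?_).symm
  simp only [G', (extChartAt IN x₀).left_inv h3] at h2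
  exact h2

section LinearAlgebra

variable {E : Type*} [AddCommGroup E] [Module ℝ E] [TopologicalSpace E]
  {E₁ : Type*} [NormedAddCommGroup E₁] [NormedSpace ℝ E₁]

/-- Here `R` projects onto `ker C`. Testing on `ker C` isolates `γ`, and surjectivity of `C` then
isolates `r`. The isomorphism `κ` only turns `r` into a covector, so that both conditions fit in one
element of `E*`. -/
theorem splitting_eq_zero_iff {γ : E →L[ℝ] ℝ} {R : E →L[ℝ] E} {C : E →L[ℝ] E₁}
    {κ : E₁ ≃ₗ[ℝ] (E₁ →L[ℝ] ℝ)} (hC : Function.Surjective C) (hR : ∀ w, C w = 0 → R w = w)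
    (hCR : ∀ w, C (R w) = 0) (r : E₁) :
    (∀ w, γ (R w) + κ r (C w) = 0) ↔ (∀ w, C w = 0 → γ w = 0) ∧ r = 0 := by
  constructor
  · intro h
    have h1 : ∀ w, C w = 0 → γ w = 0 := fun w hw => by
      have := h w
      rwa [hR w hw, hw, map_zero, add_zero] at this
    refine ⟨h1, ?_⟩
    have h2 : κ r = 0 := by
      ext y
      obtain ⟨w, rfl⟩ := hC y
      have := h w
      rwa [h1 _ (hCR w), zero_add] at this
    exact κ.map_eq_zero_iff.mp h2
  · rintro ⟨h1, rfl⟩ w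
    rw [h1 _ (hCR w), map_zero, zero_add]
    rfl

end LinearAlgebra

/-- If `D w = 0`, the splitting gives `C w = 0` and `B w = 0` on `ker C`, so `w = 0` by
nondegeneracy of `B` there. Equality of dimensions upgrades injectivity to invertibility. -/
theorem isInvertible_of_splitting {E : Type*} [NormedAddCommGroup E] [NormedSpace ℝ E]
    [FiniteDimensional ℝ E] {E₁ : Type*} [NormedAddCommGroup E₁] [NormedSpace ℝ E₁]
    {D B : E →L[ℝ] E →L[ℝ] ℝ} {R : E →L[ℝ] E} {C : E →L[ℝ] E₁}
    {κ : E₁ ≃ₗ[ℝ] (E₁ →L[ℝ] ℝ)} (hC : Function.Surjective C) (hR : ∀ w, C w = 0 → R w = w)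
    (hCR : ∀ w, C (R w) = 0) (hB : ∀ w, C w = 0 → (∀ w', C w' = 0 → B w w' = 0) → w = 0)
    (hD : ∀ w w', D w w' = B w (R w') + κ (C w) (C w')) : D.IsInvertible := by
  have hinj : LinearMap.ker D.toLinearMap = ⊥ := by
    refine LinearMap.ker_eq_bot'.mpr fun w hw => ?_
    have h1 : ∀ w', B w (R w') + κ (C w) (C w') = 0 := fun w' => by
      rw [← hD]; exact congrArg (fun l : E →L[ℝ] ℝ => l w') hw
    obtain ⟨h2, h3⟩ := (splitting_eq_zero_iff hC hR hCR (C w)).mp h1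
    exact hB w h3 h2
  have hfin : Module.finrank ℝ E = Module.finrank ℝ (E →L[ℝ] ℝ) := by
    rw [← (LinearMap.toContinuousLinearMap : (E →ₗ[ℝ] ℝ) ≃ₗ[ℝ] _).finrank_eq]
    exact Subspace.dual_finrank_eq.symm
  let e := LinearEquiv.ofInjectiveOfFinrankEq D.toLinearMap (LinearMap.ker_eq_bot.mp hinj) hfin
  exact ⟨e.toContinuousLinearEquiv, by ext; rfl⟩

end ImplicitFunctions

/-! ### The vertical projection of a connection -/

section Connections

variable {E : Type*} [NormedAddCommGroup E] [NormedSpace ℝ E]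
  {E' : Type*} [NormedAddCommGroup E'] [NormedSpace ℝ E']
  {M : Type*} [TopologicalSpace M] [ChartedSpace E M]
  {N : Type*} [TopologicalSpace N] [ChartedSpace E' N] [IsManifold 𝓘(ℝ, E) ∞ M]
  {p : C^∞⟮𝓘(ℝ, E), M; 𝓘(ℝ, E'), N⟯}

theorem mfderiv_vertIncl (x : M) (w : vert p x) :
    mfderiv 𝓘(ℝ, E) 𝓘(ℝ, E') p x (vertIncl p x w) = 0 := w.2

namespace Connection

variable (A : Connection p)

/-- The vertical projection `T_x M → V_x p ⊆ T_x M` of a connection. -/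
noncomputable def proj (x : M) : TangentSpace 𝓘(ℝ, E) x →L[ℝ] TangentSpace 𝓘(ℝ, E) x :=
  vertIncl p x ∘L A.toFun x

theorem mfderiv_proj (x : M) (w : TangentSpace 𝓘(ℝ, E) x) :
    mfderiv 𝓘(ℝ, E) 𝓘(ℝ, E') p x (A.proj x w) = 0 := mfderiv_vertIncl x _

theorem proj_of_mfderiv_eq_zero (x : M) (w : TangentSpace 𝓘(ℝ, E) x)
    (hw : mfderiv 𝓘(ℝ, E) 𝓘(ℝ, E') p x w = 0) : A.proj x w = w :=
  congrArg (vertIncl p x) (A.apply_vert x ⟨w, hw⟩)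

theorem contMDiffAt_proj_apply {ES : Type*} [NormedAddCommGroup ES] [NormedSpace ℝ ES]
    {HS : Type*} [TopologicalSpace HS] {IS : ModelWithCorners ℝ ES HS}
    {S : Type*} [TopologicalSpace S] [ChartedSpace HS S] {b : S → M}
    {X : ∀ s : S, TangentSpace 𝓘(ℝ, E) (b s)} {s : S}
    (hX : ContMDiffAt IS 𝓘(ℝ, E).tangent ∞
      (fun s => (⟨b s, X s⟩ : TangentBundle 𝓘(ℝ, E) M)) s) :
    ContMDiffAt IS 𝓘(ℝ, E).tangent ∞
      (fun s => (⟨b s, A.proj (b s) (X s)⟩ : TangentBundle 𝓘(ℝ, E) M)) s := by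
  have hb : ContMDiffAt IS 𝓘(ℝ, E) ∞ b s := (contMDiffAt_totalSpace.mp hX).1
  exact ContMDiffAt.clm_bundle_apply (A.contMDiff.contMDiffAt.comp s hb) hX

end Connection

theorem symmL_trivializationAt_self (x : M) :
    ((trivializationAt E (TangentSpace 𝓘(ℝ, E) : M → Type _) x).symmL ℝ x : E →L[ℝ] E) =
      ContinuousLinearMap.id ℝ E := by
  rw [TangentBundle.symmL_trivializationAt_eq_core (mem_chart_source E x)]
  ext v
  exact (tangentBundleCore 𝓘(ℝ, E) M).coordChange_self (achart E x) x (mem_chart_source E x) v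

end Connections

/-! ### Infinitesimal form of `f`-regularity -/

section Regularity

variable {EP : Type*} [NormedAddCommGroup EP] [NormedSpace ℝ EP]
  {EQ : Type*} [NormedAddCommGroup EQ] [NormedSpace ℝ EQ]
  {EQ₁ : Type*} [NormedAddCommGroup EQ₁] [NormedSpace ℝ EQ₁]
  {P : Type*} [TopologicalSpace P] [ChartedSpace EP P] [IsManifold 𝓘(ℝ, EP) ∞ P]
  {Q : Type*} [TopologicalSpace Q] [ChartedSpace EQ Q] [IsManifold 𝓘(ℝ, EQ) ∞ Q]
  {Q₁ : Type*} [TopologicalSpace Q₁] [ChartedSpace EQ₁ Q₁] [IsManifold 𝓘(ℝ, EQ₁) ∞ Q₁]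
  {ε : C^∞⟮𝓘(ℝ, EP), P; 𝓘(ℝ, EQ), Q⟯} {f : C^∞⟮𝓘(ℝ, EQ), Q; 𝓘(ℝ, EQ₁), Q₁⟯}

/-- The derivative at `0` of the diffeomorphism `Φ` is the fibre Hessian of `L` at `v` restricted to
vertical vectors. Differentiating `Φ⁻¹ ∘ Φ = id` shows that it is injective. -/
theorem IsFRegular.eq_zero_of_fderiv_fiberCovector {L : TP ε → ℝ} (hreg : IsFRegular f L)
    (hL : ContMDiff (TPModel EP EQ) 𝓘(ℝ) ∞ L) (p : P) (v w : EQ) (hw : w ∈ vert f (ε p))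
    (h0 : ∀ w' ∈ vert f (ε p),
      fderiv ℝ (fun v : EQ => (show EQ →L[ℝ] ℝ from fiberCovector L (⟨p, v⟩ : TP ε))) v w w' = 0) :
    w = 0 := by
  obtain ⟨Φ, hΦ⟩ := hreg ⟨p, v⟩
  let cov : EQ → EQ →L[ℝ] ℝ := fun v => fiberCovector L (⟨p, v⟩ : TP ε)
  let ι : vert f (ε p) →L[ℝ] EQ := (vert f (ε p)).subtypeL
  have hι : HasFDerivAt (fun w : vert f (ε p) => v + ι w) ι 0 :=
    ι.hasFDerivAt.const_add v
  have hcov : HasFDerivAt cov (fderiv ℝ cov v) (v + ι 0) := by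
    rw [map_zero, add_zero]
    exact ((contDiff_fiberCovector hL p).differentiable (by simp) v).hasFDerivAt
  let pre : (EQ →L[ℝ] ℝ) →L[ℝ] (vert f (ε p) →L[ℝ] ℝ) :=
    (ContinuousLinearMap.compL ℝ (vert f (ε p)) EQ ℝ).flip ι
  have hΦ' : HasFDerivAt Φ (pre ∘L fderiv ℝ cov v ∘L ι) 0 := by
    have h1 : HasFDerivAt (fun w => pre (cov (v + ι w))) (pre ∘L fderiv ℝ cov v ∘L ι) 0 :=
      HasFDerivAt.comp (g := pre) (0 : vert f (ε p)) pre.hasFDerivAt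
        (HasFDerivAt.comp (g := cov) (0 : vert f (ε p)) hcov hι)
    refine h1.congr_of_eventuallyEq (.of_forall fun w => ?_)
    exact hΦ w
  have hΨ : HasFDerivAt Φ.symm (fderiv ℝ Φ.symm (Φ 0)) (Φ 0) :=
    (Φ.symm.contMDiff.contDiff.differentiable (by simp) _).hasFDerivAt
  have hid : HasFDerivAt (fun w => Φ.symm (Φ w)) (ContinuousLinearMap.id ℝ (vert f (ε p))) 0 :=
    (hasFDerivAt_id _).congr_of_eventuallyEq (.of_forall fun w => Φ.symm_apply_apply w)
  have h1 := (hΨ.comp (0 : vert f (ε p)) hΦ').unique hid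
  have h2 : (pre ∘L fderiv ℝ cov v ∘L ι) ⟨w, hw⟩ = 0 := by
    ext w'
    exact h0 w' w'.2
  have h3 := congrArg (fun l : vert f (ε p) →L[ℝ] vert f (ε p) => l ⟨w, hw⟩) h1
  simp only [ContinuousLinearMap.comp_apply, ContinuousLinearMap.id_apply] at h3
  have h4 : (pre (fderiv ℝ cov v (ι ⟨w, hw⟩))) = 0 := h2
  rw [h4, map_zero] at h3
  exact (congrArg Subtype.val h3).symm

end Regularity

/-! ### Fibrewise linear maps of a trivialization -/

section Trivializations

variable {B : Type*} [TopologicalSpace B] {F : Type*} [NormedAddCommGroup F] [NormedSpace ℝ F]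
  {V : B → Type*} [∀ b, AddCommGroup (V b)] [∀ b, Module ℝ (V b)] [∀ b, TopologicalSpace (V b)]
  [TopologicalSpace (TotalSpace F V)] [FiberBundle F V]
  (e : Trivialization F (π F V)) [e.IsLinear ℝ] {b : B}

theorem trivialization_snd_eq (hb : b ∈ e.baseSet) (w : V b) :
    (e (⟨b, w⟩ : TotalSpace F V)).2 = e.continuousLinearMapAt ℝ b w := by
  rw [e.continuousLinearMapAt_apply ℝ, e.coe_linearMapAt_of_mem hb]

theorem continuousLinearMapAt_injective (hb : b ∈ e.baseSet) :
    Function.Injective (e.continuousLinearMapAt ℝ b) :=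
  Function.LeftInverse.injective fun w => e.symmL_continuousLinearMapAt hb w

theorem continuousLinearMapAt_surjective (hb : b ∈ e.baseSet) :
    Function.Surjective (e.continuousLinearMapAt ℝ b) :=
  Function.RightInverse.surjective fun w => e.continuousLinearMapAt_symmL hb w

end Trivializations

/-! ### Smoothness of `ψ` -/

section CompatibleMap

variable {EP₁ : Type*} [NormedAddCommGroup EP₁] [NormedSpace ℝ EP₁] [FiniteDimensional ℝ EP₁]
  {EQ₁ : Type*} [NormedAddCommGroup EQ₁] [NormedSpace ℝ EQ₁] [FiniteDimensional ℝ EQ₁]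
  {EP₂ : Type*} [NormedAddCommGroup EP₂] [NormedSpace ℝ EP₂] [FiniteDimensional ℝ EP₂]
  {EQ₂ : Type*} [NormedAddCommGroup EQ₂] [NormedSpace ℝ EQ₂] [FiniteDimensional ℝ EQ₂]
  {P₁ : Type*} [TopologicalSpace P₁] [ChartedSpace EP₁ P₁] [IsManifold 𝓘(ℝ, EP₁) ∞ P₁]
  {Q₁ : Type*} [TopologicalSpace Q₁] [ChartedSpace EQ₁ Q₁] [IsManifold 𝓘(ℝ, EQ₁) ∞ Q₁]
  {P₂ : Type*} [TopologicalSpace P₂] [ChartedSpace EP₂ P₂] [IsManifold 𝓘(ℝ, EP₂) ∞ P₂]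
  {Q₂ : Type*} [TopologicalSpace Q₂] [ChartedSpace EQ₂ Q₂] [IsManifold 𝓘(ℝ, EQ₂) ∞ Q₂]
  {ε₁ : C^∞⟮𝓘(ℝ, EP₁), P₁; 𝓘(ℝ, EQ₁), Q₁⟯} {ε₂ : C^∞⟮𝓘(ℝ, EP₂), P₂; 𝓘(ℝ, EQ₂), Q₂⟯}
  {F : C^∞⟮𝓘(ℝ, EP₁), P₁; 𝓘(ℝ, EP₂), P₂⟯} {f : C^∞⟮𝓘(ℝ, EQ₂), Q₂; 𝓘(ℝ, EQ₁), Q₁⟯}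
  (h : IsTransformationPair ε₁ ε₂ F f) {L₂ : TP ε₂ → ℝ} (hL : IsFRegular f L₂)
  (β : VDualMap (ES := EP₁) f (fun p : P₁ => ε₂ (F p)))

theorem mfderiv_psiTQ (s : TP ε₁) :
    (show EQ₁ from mfderiv 𝓘(ℝ, EQ₂) 𝓘(ℝ, EQ₁) f (ε₂ (F s.proj)) (psiTQ h hL β s)) =
      (show EQ₁ from s.snd) :=
  (h.compatible_iff s _).mp (compatible_psi h hL β s)

theorem IsTransformationPair.tau₁_eq_mk (h : IsTransformationPair ε₁ ε₂ F f) (s : TP ε₁) :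
    tau₁ s = (⟨f (ε₂ (F s.proj)), (show EQ₁ from s.snd)⟩ : TangentBundle 𝓘(ℝ, EQ₁) Q₁) :=
  TotalSpace.ext (h.comm s.proj).symm HEq.rfl

/-- Existence and uniqueness of `ψ` as a pair of equations. The premise on `w` is automatic; it
matches the shape of `splitting_eq_zero_iff`. -/
theorem eq_psiTQ_iff (s : TP ε₁) (v : TangentSpace 𝓘(ℝ, EQ₂) (ε₂ (F s.proj))) :
    v = psiTQ h hL β s ↔
      (∀ w, mfderiv 𝓘(ℝ, EQ₂) 𝓘(ℝ, EQ₁) f (ε₂ (F s.proj)) (vertIncl f _ w) = 0 →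
        fiberCovector L₂ (⟨F s.proj, v⟩ : TP ε₂) (vertIncl f _ w) = β.toFun s.proj w) ∧
      (show EQ₁ from mfderiv 𝓘(ℝ, EQ₂) 𝓘(ℝ, EQ₁) f (ε₂ (F s.proj)) v) =
        (show EQ₁ from s.snd) := by
  constructor
  · rintro rfl
    refine ⟨fun w _ => ?_, mfderiv_psiTQ h hL β s⟩
    exact congrArg (fun l => l w) (alpha_psi h hL β s)
  · rintro ⟨h1, h2⟩
    refine eq_psi_of_compatible h hL β s v ((h.compatible_iff s v).mpr h2) ?_
    ext w
    exact h1 w (mfderiv_vertIncl _ w)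

theorem contMDiff_psi (A : Connection f) (hL₂ : ContMDiff (TPModel EP₂ EQ₂) 𝓘(ℝ) ∞ L₂) :
    ContMDiff (TPModel EP₁ EQ₁) (TPModel EP₂ EQ₂) ∞ (psi h hL β) := by
  intro s₀
  set p₀ := s₀.proj with hp₀
  set e := trivializationAt EQ₂ (TangentSpace 𝓘(ℝ, EQ₂) : Q₂ → Type _) (ε₂ (F p₀)) with he
  set c := trivializationAt EQ₁ (TangentSpace 𝓘(ℝ, EQ₁) : Q₁ → Type _) (f (ε₂ (F p₀))) with hc
  have he₀ : ε₂ (F p₀) ∈ e.baseSet := mem_baseSet_trivializationAt _ _ _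
  have hc₀ : f (ε₂ (F p₀)) ∈ c.baseSet := mem_baseSet_trivializationAt _ _ _
  obtain ⟨U, hUo, hU₀, b, hb, hbβ⟩ := β.smooth p₀
  -- Any isomorphism will do: `κ` serves only to encode the condition on `Tf` as a covector.
  obtain ⟨κ⟩ : Nonempty (EQ₁ ≃ₗ[ℝ] (EQ₁ →L[ℝ] ℝ)) := by
    refine ⟨LinearEquiv.ofFinrankEq _ _ ?_⟩
    rw [← (LinearMap.toContinuousLinearMap : (EQ₁ →ₗ[ℝ] ℝ) ≃ₗ[ℝ] _).finrank_eq]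
    exact Subspace.dual_finrank_eq.symm
  have hFp : ContMDiff (TPModel EP₁ EQ₁) 𝓘(ℝ, EP₂) ∞ (fun s : TP ε₁ => F s.proj) :=
    F.contMDiff.comp contMDiff_tau₂
  have hq : ContMDiff (TPModel EP₁ EQ₁) 𝓘(ℝ, EQ₂) ∞ (fun s : TP ε₁ => ε₂ (F s.proj)) :=
    ε₂.contMDiff.comp hFp
  have hfq : ContMDiff (TPModel EP₁ EQ₁) 𝓘(ℝ, EQ₁) ∞ (fun s : TP ε₁ => f (ε₂ (F s.proj))) :=
    f.contMDiff.comp hq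
  let t : TP ε₁ → EQ₂ := fun s => (e (tau₁ (psi h hL β s))).2
  suffices ht : ContMDiffAt (TPModel EP₁ EQ₁) 𝓘(ℝ, EQ₂) ∞ t s₀ by
    refine contMDiffAt_TP_iff.mpr ⟨hFp s₀, contMDiffAt_totalSpace.mpr ⟨hq s₀, ht⟩⟩
  let l : ∀ s : TP ε₁, EQ₂ →L[ℝ] TangentSpace 𝓘(ℝ, EQ₂) (ε₂ (F s.proj)) := fun s =>
    e.symmL ℝ (ε₂ (F s.proj))
  let C : ∀ s : TP ε₁, TangentSpace 𝓘(ℝ, EQ₂) (ε₂ (F s.proj)) →L[ℝ] EQ₁ := fun s =>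
    c.continuousLinearMapAt ℝ (f (ε₂ (F s.proj))) ∘L
      mfderiv 𝓘(ℝ, EQ₂) 𝓘(ℝ, EQ₁) f (ε₂ (F s.proj))
  -- The local lift `b` of `β` is a full covector; its arbitrary part is harmless, since `γ` enters
  -- `G` only after the vertical projection of `A`.
  let γ : ∀ s : TP ε₁, EQ₂ → TangentSpace 𝓘(ℝ, EQ₂) (ε₂ (F s.proj)) →L[ℝ] ℝ := fun s y =>
    fiberCovector L₂ (⟨F s.proj, l s y⟩ : TP ε₂) - b s.proj
  -- The first term imposes `α_{L₂} = β`, the second `Tf(v₂) = v₁`. Near `s₀` the only zero of `G s`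
  -- is the coordinate `t s` of `ψ(s)`.
  let G : TP ε₁ → EQ₂ → EQ₂ →L[ℝ] ℝ := fun s y =>
    γ s y ∘L A.proj (ε₂ (F s.proj)) ∘L l s +
      κ (C s (l s y) - (c (tau₁ s)).2) ∘L C s ∘L l s
  have hgood : ∀ᶠ s : TP ε₁ in 𝓝 s₀, s.proj ∈ U ∧ ε₂ (F s.proj) ∈ e.baseSet ∧
      f (ε₂ (F s.proj)) ∈ c.baseSet :=
    (contMDiff_tau₂.continuous.continuousAt.eventually (hUo.mem_nhds hU₀)).and
      ((hq.continuous.continuousAt.eventually (e.open_baseSet.mem_nhds he₀)).and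
        (hfq.continuous.continuousAt.eventually (c.open_baseSet.mem_nhds hc₀)))
  have hC0 : ∀ s : TP ε₁, f (ε₂ (F s.proj)) ∈ c.baseSet → ∀ w, C s w = 0 ↔
      mfderiv 𝓘(ℝ, EQ₂) 𝓘(ℝ, EQ₁) f (ε₂ (F s.proj)) w = 0 := fun s hs _ =>
    map_eq_zero_iff (c.continuousLinearMapAt ℝ (f (ε₂ (F s.proj))))
      (continuousLinearMapAt_injective c hs)
  have hCsurj : ∀ s : TP ε₁, f (ε₂ (F s.proj)) ∈ c.baseSet → Function.Surjective (C s) :=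
    fun s hs => (continuousLinearMapAt_surjective c hs).comp
      (h.submersion_f.mfderiv_surjective _)
  have hCR : ∀ s : TP ε₁, f (ε₂ (F s.proj)) ∈ c.baseSet →
      ∀ w, C s (A.proj (ε₂ (F s.proj)) w) = 0 := fun s hs w =>
    (hC0 s hs _).mpr (A.mfderiv_proj _ w)
  have hRC : ∀ s : TP ε₁, f (ε₂ (F s.proj)) ∈ c.baseSet →
      ∀ w, C s w = 0 → A.proj (ε₂ (F s.proj)) w = w := fun s hs w hw =>
    A.proj_of_mfderiv_eq_zero _ w ((hC0 s hs w).mp hw)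
  have hle : ∀ s : TP ε₁, ε₂ (F s.proj) ∈ e.baseSet → ∀ w,
      l s (e.continuousLinearMapAt ℝ (ε₂ (F s.proj)) w) = w := fun s hs w =>
    e.symmL_continuousLinearMapAt hs w
  have hlt : ∀ s : TP ε₁, ε₂ (F s.proj) ∈ e.baseSet → ∀ y,
      y = t s ↔ l s y = psiTQ h hL β s := fun s hs y => by
    have h1 : t s = e.continuousLinearMapAt ℝ (ε₂ (F s.proj)) (psiTQ h hL β s) :=
      trivialization_snd_eq e hs _
    rw [h1]
    constructor
    · rintro rfl; exact hle s hs _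
    · intro h2; rw [← h2]; exact (e.continuousLinearMapAt_symmL hs y).symm
  have hzero : ∀ᶠ s in 𝓝 s₀, ∀ y : EQ₂, G s y = 0 ↔ y = t s := by
    filter_upwards [hgood] with s ⟨hsU, hse, hsc⟩ y
    rw [hlt s hse, eq_psiTQ_iff]
    have h1 : G s y = 0 ↔ ∀ w, γ s y (A.proj (ε₂ (F s.proj)) w) +
        κ (C s (l s y) - (c (tau₁ s)).2) (C s w) = 0 := by
      constructor
      · intro h0 w
        have h2 : γ s y (A.proj (ε₂ (F s.proj)) (l s (e.continuousLinearMapAt ℝ _ w))) +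
            κ (C s (l s y) - (c (tau₁ s)).2) (C s (l s (e.continuousLinearMapAt ℝ _ w))) = 0 :=
          congrArg (fun m : EQ₂ →L[ℝ] ℝ => m (e.continuousLinearMapAt ℝ _ w)) h0
        rwa [hle s hse] at h2
      · intro h0
        ext δ
        exact h0 (l s δ)
    rw [h1, splitting_eq_zero_iff (hCsurj s hsc) (hRC s hsc) (hCR s hsc)]
    refine and_congr ?_ ?_
    · have h2 : ∀ w : vert f (ε₂ (F s.proj)), γ s y (vertIncl f _ w) =
          fiberCovector L₂ (⟨F s.proj, l s y⟩ : TP ε₂) (vertIncl f _ w) - β.toFun s.proj w := by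
        intro w
        rw [← hbβ s.proj hsU]
        rfl
      constructor
      · intro h3 w hw
        exact sub_eq_zero.mp ((h2 w).symm.trans (h3 _ ((hC0 s hsc _).mpr hw)))
      · intro h3 w hw
        have hw' := (hC0 s hsc w).mp hw
        exact (h2 ⟨w, hw'⟩).trans (sub_eq_zero.mpr (h3 ⟨w, hw'⟩ hw'))
    · have h3 : (c (tau₁ s)).2 = c.continuousLinearMapAt ℝ (f (ε₂ (F s.proj)))
          (show EQ₁ from s.snd) :=
        (congrArg (fun X => (c X).2) (h.tau₁_eq_mk s)).trans (trivialization_snd_eq c hsc _)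
      rw [sub_eq_zero, h3]
      exact (continuousLinearMapAt_injective c hsc).eq_iff
  let k : EQ₁ →L[ℝ] EQ₁ →L[ℝ] ℝ := LinearMap.toContinuousLinearMap κ.toLinearMap
  refine contMDiffAt_of_implicit (G := G) ?_ hzero ?_
  · refine contMDiffAt_dual_of_apply fun δ => ?_
    have hgood' : ∀ᶠ x : TP ε₁ × EQ₂ in 𝓝 (s₀, t s₀), x.1.proj ∈ U ∧
        ε₂ (F x.1.proj) ∈ e.baseSet ∧ f (ε₂ (F x.1.proj)) ∈ c.baseSet :=
      hgood.prod_inl_nhds (t s₀)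
    have hpt : ∀ y : TP ε₁ × EQ₂ → EQ₂,
        ContMDiffAt ((TPModel EP₁ EQ₁).prod 𝓘(ℝ, EQ₂)) 𝓘(ℝ, EQ₂) ∞ y (s₀, t s₀) →
        ContMDiffAt ((TPModel EP₁ EQ₁).prod 𝓘(ℝ, EQ₂)) (TPModel EP₂ EQ₂) ∞
          (fun x => (⟨F x.1.proj, l x.1 (y x)⟩ : TP ε₂)) (s₀, t s₀) := by
      intro y hy
      have h1 := contMDiffAt_trivializationAt_symm (ε := ε₂) (F p₀) (F p₀) (y (s₀, t s₀)) he₀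
      have h2 : ContMDiffAt ((TPModel EP₁ EQ₁).prod 𝓘(ℝ, EQ₂)) (TPModel EP₂ EQ₂) ∞
          (fun x : TP ε₁ × EQ₂ => (F x.1.proj, y x)) (s₀, t s₀) :=
        (hFp.contMDiffAt.comp (s₀, t s₀) contMDiffAt_fst).prodMk hy
      refine (ContMDiffAt.comp (g := fun x : P₂ × EQ₂ => (⟨x.1, e.symm (ε₂ x.1) x.2⟩ : TP ε₂))
        (s₀, t s₀) h1 h2).congr_of_eventuallyEq ?_
      filter_upwards [hgood'] with x ⟨_, hx, _⟩
      exact congrArg (fun w => (⟨F x.1.proj, w⟩ : TP ε₂)) (e.symmL_apply hx (y x))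
    have hsec := fun y hy => (contMDiff_tau₁ (ε := ε₂)).contMDiffAt.comp (s₀, t s₀) (hpt y hy)
    have hR := A.contMDiffAt_proj_apply (hsec (fun _ => δ) contMDiffAt_const)
    have T1 := contMDiffAt_pairing
      (a := fun x : TP ε₁ × EQ₂ => fiberCovector L₂ (⟨F x.1.proj, l x.1 x.2⟩ : TP ε₂))
      ((contMDiff_fiberCovector hL₂).contMDiffAt.comp (s₀, t s₀) (hpt _ contMDiffAt_snd)) hR
    have T2 := contMDiffAt_pairing (a := fun x : TP ε₁ × EQ₂ => b x.1.proj)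
      (ContMDiffAt.comp (s₀, t s₀) (hb.contMDiffAt (hUo.mem_nhds hU₀))
        (contMDiff_tau₂.contMDiffAt.comp (s₀, t s₀) contMDiffAt_fst)) hR
    have hC : ∀ y : TP ε₁ × EQ₂ → EQ₂,
        ContMDiffAt ((TPModel EP₁ EQ₁).prod 𝓘(ℝ, EQ₂)) 𝓘(ℝ, EQ₂) ∞ y (s₀, t s₀) →
        ContMDiffAt ((TPModel EP₁ EQ₁).prod 𝓘(ℝ, EQ₂)) 𝓘(ℝ, EQ₁) ∞
          (fun x => C x.1 (l x.1 (y x))) (s₀, t s₀) := by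
      intro y hy
      have h1 := (f.contMDiff.contMDiff_tangentMap (m := ∞) (by simp)).contMDiffAt.comp
        (s₀, t s₀) (hsec y hy)
      refine (contMDiffAt_totalSpace.mp h1).2.congr_of_eventuallyEq ?_
      filter_upwards [hgood'] with x ⟨_, _, hx⟩
      exact (trivialization_snd_eq c hx _).symm
    have hτ : ContMDiffAt ((TPModel EP₁ EQ₁).prod 𝓘(ℝ, EQ₂)) 𝓘(ℝ, EQ₁) ∞
        (fun x : TP ε₁ × EQ₂ => (c (tau₁ x.1)).2) (s₀, t s₀) := by
      have hs : tau₁ s₀ ∈ c.source := by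
        rw [c.mem_source]
        change ε₁ s₀.proj ∈ c.baseSet
        rw [← h.comm]
        exact hc₀
      exact ContMDiffAt.comp (g := fun s : TP ε₁ => (c (tau₁ s)).2) (s₀, t s₀)
        ((c.contMDiffAt_iff hs).mp (contMDiff_tau₁ s₀)).2 contMDiffAt_fst
    exact (T1.sub T2).add (((k.contMDiff.contMDiffAt.comp (s₀, t s₀)
      ((hC _ contMDiffAt_snd).sub hτ))).clm_apply (hC _ contMDiffAt_const))
  · let cov : EQ₂ → EQ₂ →L[ℝ] ℝ := fun v => fiberCovector L₂ (⟨F p₀, v⟩ : TP ε₂)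
    let b₀ : EQ₂ →L[ℝ] ℝ := b p₀
    let R₀ : EQ₂ →L[ℝ] EQ₂ := A.proj (ε₂ (F p₀))
    let C₀ : EQ₂ →L[ℝ] EQ₁ := C s₀
    -- Over its own centre the trivialization is the identity, so the partial derivative of `G` at
    -- `s₀` involves no change of coordinates.
    have hl₀ : l s₀ = ContinuousLinearMap.id ℝ EQ₂ := symmL_trivializationAt_self _
    have hcov : HasFDerivAt cov (fderiv ℝ cov (t s₀)) (t s₀) :=
      ((contDiff_fiberCovector hL₂ (F p₀)).differentiable (by simp) _).hasFDerivAt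
    have hG₀ : G s₀ = fun y => (cov y - b₀) ∘L R₀ + k (C₀ y - (c (tau₁ s₀)).2) ∘L C₀ := by
      funext y
      simp only [G, γ]
      rw [hl₀]
      rfl
    let D : EQ₂ →L[ℝ] EQ₂ →L[ℝ] ℝ :=
      (ContinuousLinearMap.compL ℝ EQ₂ EQ₂ ℝ).flip R₀ ∘L fderiv ℝ cov (t s₀) +
        (ContinuousLinearMap.compL ℝ EQ₂ EQ₁ ℝ).flip C₀ ∘L k ∘L C₀
    have hD : HasFDerivAt (G s₀) D (t s₀) := by
      rw [hG₀]
      refine HasFDerivAt.add ?_ ?_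
      · exact ((ContinuousLinearMap.compL ℝ EQ₂ EQ₂ ℝ).flip R₀).hasFDerivAt.comp (t s₀)
          (hcov.sub_const b₀)
      · exact ((ContinuousLinearMap.compL ℝ EQ₂ EQ₁ ℝ).flip C₀).hasFDerivAt.comp (t s₀)
          (k.hasFDerivAt.comp (t s₀) (C₀.hasFDerivAt.sub_const _))
    rw [hD.fderiv]
    -- `B` is the fibre Hessian of `L₂`, nondegenerate on vertical vectors by `f`-regularity.
    refine isInvertible_of_splitting (B := fderiv ℝ cov (t s₀)) (R := R₀) (C := C₀) (κ := κ)
      (hCsurj s₀ hc₀) (hRC s₀ hc₀) (hCR s₀ hc₀) ?_ (fun w w' => rfl)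
    intro w hw hw'
    refine hL.eq_zero_of_fderiv_fiberCovector hL₂ (F p₀) (t s₀) w ((hC0 s₀ hc₀ w).mp hw) ?_
    intro w' hw''
    exact hw' w' ((hC0 s₀ hc₀ w').mpr hw'')

end CompatibleMap

/-! ### The Poincaré-Cartan form in terms of a 1-form -/

section PoincareCartan

variable {EP : Type*} [NormedAddCommGroup EP] [NormedSpace ℝ EP] [FiniteDimensional ℝ EP]
  {EQ : Type*} [NormedAddCommGroup EQ] [NormedSpace ℝ EQ] [FiniteDimensional ℝ EQ]
  {P : Type*} [TopologicalSpace P] [ChartedSpace EP P] [IsManifold 𝓘(ℝ, EP) ∞ P]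
  {Q : Type*} [TopologicalSpace Q] [ChartedSpace EQ Q] [IsManifold 𝓘(ℝ, EQ) ∞ Q]
  {ε : C^∞⟮𝓘(ℝ, EP), P; 𝓘(ℝ, EQ), Q⟯}

theorem pullback_canonicalOneForm_apply
    {EN : Type*} [NormedAddCommGroup EN] [NormedSpace ℝ EN]
    {HN : Type*} [TopologicalSpace HN] {IN : ModelWithCorners ℝ EN HN}
    {N : Type*} [TopologicalSpace N] [ChartedSpace HN N] {g : N → Cotangent EQ Q} {x : N}
    (hg : MDifferentiableAt IN (𝓘(ℝ, EQ).prod 𝓘(ℝ, EQ →L[ℝ] ℝ)) g x)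
    (v : Fin 1 → TangentSpace IN x) :
    DForm.pullback (I := IN) g (canonicalOneForm EQ Q) x v =
      (g x).snd (mfderiv IN 𝓘(ℝ, EQ) (fun y => (g y).proj) x (v 0)) := by
  have h1 : MDifferentiableAt (𝓘(ℝ, EQ).prod 𝓘(ℝ, EQ →L[ℝ] ℝ)) 𝓘(ℝ, EQ)
      (fun b : Cotangent EQ Q => b.proj) (g x) :=
    (contMDiff_proj (n := ∞) _).mdifferentiable (by simp) _
  have h2 : mfderiv IN 𝓘(ℝ, EQ) (fun y => (g y).proj) x = _ := mfderiv_comp x h1 hg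
  rw [h2]
  rfl

/-- Naturality of `d` moves it outside the pull-back, so that Poincaré-Cartan forms can be compared
through 1-forms. -/
theorem poincareCartan_eq {L : TP ε → ℝ} (hL : ContMDiff (TPModel EP EQ) 𝓘(ℝ) ∞ L)
    (B : DForm 𝓘(ℝ, EP) P 2) :
    poincareCartan L B =
      (DForm.pullback (I := TPModel EP EQ) (fun s => pi₁ (legendre L s))
        (canonicalOneForm EQ Q)).d + DForm.pullback tau₂ B := by
  have hl := contMDiff_legendre hL
  have h1 : DForm.pullback (I := TPModel EP EQ) (legendre L)
      (DForm.pullback (I := TPDualModel EP EQ) pi₁ (canonicalTwoForm EQ Q)) =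
      (DForm.pullback (I := TPModel EP EQ) (fun s => pi₁ (legendre L s))
        (canonicalOneForm EQ Q)).d := by
    rw [DForm.pullback_pullback _ (hl.mdifferentiable (by simp))
      (contMDiff_pi₁.mdifferentiable (by simp))]
    funext s
    exact (DForm.d_pullback isSmooth_canonicalOneForm ((contMDiff_pi₁.comp hl) s)).symm
  have h2 : DForm.pullback (I := TPModel EP EQ) (legendre L)
      (DForm.pullback (I := TPDualModel EP EQ) pi₂ B) = DForm.pullback tau₂ B :=
    DForm.pullback_pullback _ (hl.mdifferentiable (by simp))
      (contMDiff_pi₂.mdifferentiable (by simp))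
  rw [← h1, ← h2]
  rfl

end PoincareCartan

/-! ### The induced system and the two identities -/

section Reduction

variable {EP₁ : Type*} [NormedAddCommGroup EP₁] [NormedSpace ℝ EP₁] [FiniteDimensional ℝ EP₁]
  {EQ₁ : Type*} [NormedAddCommGroup EQ₁] [NormedSpace ℝ EQ₁] [FiniteDimensional ℝ EQ₁]
  {EP₂ : Type*} [NormedAddCommGroup EP₂] [NormedSpace ℝ EP₂] [FiniteDimensional ℝ EP₂]
  {EQ₂ : Type*} [NormedAddCommGroup EQ₂] [NormedSpace ℝ EQ₂] [FiniteDimensional ℝ EQ₂]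
  {P₁ : Type*} [TopologicalSpace P₁] [ChartedSpace EP₁ P₁] [IsManifold 𝓘(ℝ, EP₁) ∞ P₁]
  {Q₁ : Type*} [TopologicalSpace Q₁] [ChartedSpace EQ₁ Q₁] [IsManifold 𝓘(ℝ, EQ₁) ∞ Q₁]
  {P₂ : Type*} [TopologicalSpace P₂] [ChartedSpace EP₂ P₂] [IsManifold 𝓘(ℝ, EP₂) ∞ P₂]
  {Q₂ : Type*} [TopologicalSpace Q₂] [ChartedSpace EQ₂ Q₂] [IsManifold 𝓘(ℝ, EQ₂) ∞ Q₂]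
  {ε₁ : C^∞⟮𝓘(ℝ, EP₁), P₁; 𝓘(ℝ, EQ₁), Q₁⟯} {ε₂ : C^∞⟮𝓘(ℝ, EP₂), P₂; 𝓘(ℝ, EQ₂), Q₂⟯}
  {F : C^∞⟮𝓘(ℝ, EP₁), P₁; 𝓘(ℝ, EP₂), P₂⟯} {f : C^∞⟮𝓘(ℝ, EQ₂), Q₂; 𝓘(ℝ, EQ₁), Q₁⟯}
  (h : IsTransformationPair ε₁ ε₂ F f) {L₂ : TP ε₂ → ℝ} (hL : IsFRegular f L₂)
  (β : VDualMap (ES := EP₁) f (fun p : P₁ => ε₂ (F p))) (A : Connection f)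

/-- Locally `⟨β, 𝒜 X⟩` is the pairing of a smooth lift of `β` to `T^*Q₂` with the vertical
projection of `X`. -/
theorem contMDiffAt_beta_connection {ES : Type*} [NormedAddCommGroup ES] [NormedSpace ℝ ES]
    {HS : Type*} [TopologicalSpace HS] {IS : ModelWithCorners ℝ ES HS}
    {S : Type*} [TopologicalSpace S] [ChartedSpace HS S] {p : S → P₁}
    {X : ∀ s : S, TangentSpace 𝓘(ℝ, EQ₂) (ε₂ (F (p s)))} {s : S}
    (hp : ContMDiffAt IS 𝓘(ℝ, EP₁) ∞ p s)
    (hX : ContMDiffAt IS 𝓘(ℝ, EQ₂).tangent ∞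
      (fun s => (⟨ε₂ (F (p s)), X s⟩ : TangentBundle 𝓘(ℝ, EQ₂) Q₂)) s) :
    ContMDiffAt IS 𝓘(ℝ) ∞ (fun s => β.toFun (p s) (A.toFun (ε₂ (F (p s))) (X s))) s := by
  obtain ⟨U, hUo, hU₀, b, hb, hbβ⟩ := β.smooth (p s)
  have h1 := contMDiffAt_pairing (a := fun s => b (p s))
    (ContMDiffAt.comp s (hb.contMDiffAt (hUo.mem_nhds hU₀)) hp) (A.contMDiffAt_proj_apply hX)
  refine h1.congr_of_eventuallyEq ?_
  filter_upwards [hp.continuousAt (hUo.mem_nhds hU₀)] with s' hs'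
  rw [← hbβ (p s') hs']
  rfl

theorem contMDiff_inducedLagrangian (hL₂ : ContMDiff (TPModel EP₂ EQ₂) 𝓘(ℝ) ∞ L₂) :
    ContMDiff (TPModel EP₁ EQ₁) 𝓘(ℝ) ∞ (inducedLagrangian h hL β A) := by
  have hψ := contMDiff_psi h hL β A hL₂
  exact (hL₂.comp hψ).sub fun s =>
    contMDiffAt_beta_connection β A contMDiff_tau₂.contMDiffAt (contMDiff_tau₁.comp hψ s)

theorem isSmooth_betaConnection : (betaConnection β A).IsSmooth := by
  refine DForm.isSmooth_oneForm fun X => ?_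
  have h1 : ContMDiff 𝓘(ℝ, EP₁) 𝓘(ℝ, EQ₂) ∞ (fun p : P₁ => ε₂ (F p)) :=
    ε₂.contMDiff.comp F.contMDiff
  exact contMDiffAt_beta_connection β A
    (contMDiff_proj (TangentSpace 𝓘(ℝ, EP₁) : P₁ → Type _) X)
    (h1.contMDiff_tangentMap (m := ∞) (by simp) X)

theorem isSmooth_inducedMagnetic {B₂ : DForm 𝓘(ℝ, EP₂) P₂ 2} (hB : B₂.IsSmooth) :
    (inducedMagnetic β A B₂).IsSmooth :=
  (hB.pullback F.contMDiff).add (isSmooth_betaConnection β A).d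

theorem d_inducedMagnetic {B₂ : DForm 𝓘(ℝ, EP₂) P₂ 2} (hB : B₂.IsSmooth) (hd : B₂.d = 0) :
    (inducedMagnetic β A B₂).d = 0 := by
  have hβ := isSmooth_betaConnection β A
  rw [inducedMagnetic, DForm.d_add (hB.pullback F.contMDiff) hβ.d, DForm.d_d hβ, add_zero]
  funext p
  rw [DForm.d_pullback hB F.contMDiff.contMDiffAt, hd]
  rfl

theorem contDiff_psiTQ_fiber (A : Connection f)
    (hL₂ : ContMDiff (TPModel EP₂ EQ₂) 𝓘(ℝ) ∞ L₂) (p : P₁) :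
    ContDiff ℝ ∞ (fun v : EQ₁ => (show EQ₂ from psiTQ h hL β (⟨p, v⟩ : TP ε₁))) := by
  refine ContMDiff.contDiff fun v => ?_
  have h1 := (contMDiffAt_totalSpace.mp ((contMDiff_tau₁.comp
    ((contMDiff_psi h hL β A hL₂).comp (contMDiff_TPFiber p))) v)).2
  refine h1.congr_of_eventuallyEq (.of_forall fun w => ?_)
  exact (tangentCoordChange_self (I := 𝓘(ℝ, EQ₂)) (x := ε₂ (F p))
    (mem_extChartAt_source _)).symm

/-- The central identity. The covector `𝔽L₂(ψ) - ⟨β, 𝒜⟩` kills `ker Tf`, and its composite with the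
section `Dγ` of `Tf` is the fibre derivative of `L₁`. -/
theorem fiberCovector_inducedLagrangian (hL₂ : ContMDiff (TPModel EP₂ EQ₂) 𝓘(ℝ) ∞ L₂)
    (s : TP ε₁) (Y : TangentSpace 𝓘(ℝ, EQ₂) (ε₂ (F s.proj))) :
    fiberCovector L₂ (psi h hL β s) Y =
      (show EQ₁ →L[ℝ] ℝ from fiberCovector (inducedLagrangian h hL β A) s)
        (mfderiv 𝓘(ℝ, EQ₂) 𝓘(ℝ, EQ₁) f (ε₂ (F s.proj)) Y) +
      β.toFun s.proj (A.toFun (ε₂ (F s.proj)) Y) := by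
  let p := s.proj
  let v : EQ₁ := s.snd
  let Z : EQ₂ := Y
  let γ : EQ₁ → EQ₂ := fun v => psiTQ h hL β (⟨p, v⟩ : TP ε₁)
  let C : EQ₂ →L[ℝ] EQ₁ := mfderiv 𝓘(ℝ, EQ₂) 𝓘(ℝ, EQ₁) f (ε₂ (F p))
  let βA : EQ₂ →L[ℝ] ℝ := β.toFun p ∘L A.toFun (ε₂ (F p))
  let cov : EQ₂ →L[ℝ] ℝ := fiberCovector L₂ (psi h hL β s)
  have hγ : HasFDerivAt γ (fderiv ℝ γ v) v :=
    ((contDiff_psiTQ_fiber h hL β A hL₂ p).differentiable (by simp) v).hasFDerivAt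
  have hCγ : C ∘L fderiv ℝ γ v = ContinuousLinearMap.id ℝ EQ₁ := by
    refine (C.hasFDerivAt.comp v hγ).unique
      ((hasFDerivAt_id v).congr_of_eventuallyEq (.of_forall fun w => ?_))
    exact mfderiv_psiTQ h hL β (⟨p, w⟩ : TP ε₁)
  have hcov : HasFDerivAt (fun w : EQ₂ => L₂ ⟨F p, w⟩) cov (γ v) :=
    ((contDiff_fiber hL₂ (F p)).differentiable (by simp) (γ v)).hasFDerivAt
  have hL₁ : (show EQ₁ →L[ℝ] ℝ from
      fiberCovector (inducedLagrangian h hL β A) s) =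
      cov ∘L fderiv ℝ γ v - βA ∘L fderiv ℝ γ v :=
    ((hcov.comp v hγ).sub (βA.hasFDerivAt.comp v hγ)).fderiv
  have hvert : ∀ w : EQ₂, C w = 0 → cov w = βA w := by
    intro w hw
    have h1 := congrArg (fun l => l ⟨w, hw⟩) (alpha_psi h hL β s)
    have h2 := congrArg (β.toFun p) (A.apply_vert (ε₂ (F p)) ⟨w, hw⟩)
    exact h1.trans h2.symm
  -- `Dγ(Tf Z)` and `Z` have the same image under `Tf`, so their difference is vertical.
  have hY := hvert (fderiv ℝ γ v (C Z) - Z) (by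
    rw [map_sub, sub_eq_zero]
    exact congrArg (fun l : EQ₁ →L[ℝ] EQ₁ => l (C Z)) hCγ)
  rw [map_sub, map_sub] at hY
  have hCZ : (show EQ₁ →L[ℝ] ℝ from fiberCovector (inducedLagrangian h hL β A) s) (C Z) =
      cov (fderiv ℝ γ v (C Z)) - βA (fderiv ℝ γ v (C Z)) :=
    congrArg (fun l : EQ₁ →L[ℝ] ℝ => l (C Z)) hL₁
  change cov Z =
    (show EQ₁ →L[ℝ] ℝ from fiberCovector (inducedLagrangian h hL β A) s) (C Z) + βA Z
  linarith

/-- The central identity at `Y = ψ^{TQ₂}(s)`, where `Tf Y = v₁`: its term `⟨β, 𝒜 Y⟩` is the one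
subtracted in `L₁`. -/
theorem energy_psi (hL₂ : ContMDiff (TPModel EP₂ EQ₂) 𝓘(ℝ) ∞ L₂) (s : TP ε₁) :
    energy L₂ (psi h hL β s) = energy (inducedLagrangian h hL β A) s := by
  have h1 := fiberCovector_inducedLagrangian h hL β A hL₂ s (psiTQ h hL β s)
  have h2 := congrArg (show EQ₁ →L[ℝ] ℝ from fiberCovector (inducedLagrangian h hL β A) s)
    (mfderiv_psiTQ h hL β s)
  have h3 : energy L₂ (psi h hL β s) =
    fiberCovector L₂ (psi h hL β s) (psiTQ h hL β s) - L₂ (psi h hL β s) := rfl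
  have h4 : inducedLagrangian h hL β A s = L₂ (psi h hL β s) -
    β.toFun s.proj (A.toFun (ε₂ (F s.proj)) (psiTQ h hL β s)) := rfl
  have h5 : energy (inducedLagrangian h hL β A) s =
    (show EQ₁ →L[ℝ] ℝ from fiberCovector (inducedLagrangian h hL β A) s)
      (show EQ₁ from s.snd) - inducedLagrangian h hL β A s := rfl
  rw [h3, h5, h4, h1, ← h2]
  exact add_sub_assoc _ _ _ |>.trans (sub_sub_eq_add_sub _ _ _ |>.trans
    (add_sub_assoc _ _ _)).symm

/-- The central identity at `Y = T(ε₂ ∘ F ∘ τ₂)(X)`; since `f ∘ ε₂ ∘ F = ε₁`, the vector `Tf Y` is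
`T(ε₁ ∘ τ₂)(X)`, the one that the canonical 1-form on `T^*Q₁` sees. -/
theorem pullback_psi_canonicalOneForm (hL₂ : ContMDiff (TPModel EP₂ EQ₂) 𝓘(ℝ) ∞ L₂) :
    DForm.pullback (I := TPModel EP₁ EQ₁) (fun s => pi₁ (legendre L₂ (psi h hL β s)))
        (canonicalOneForm EQ₂ Q₂) =
      DForm.pullback (I := TPModel EP₁ EQ₁)
        (fun s => pi₁ (legendre (inducedLagrangian h hL β A) s)) (canonicalOneForm EQ₁ Q₁) +
      DForm.pullback (tau₂ : TP ε₁ → P₁) (betaConnection β A) := by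
  funext s
  ext X
  have hl₂ := contMDiff_pi₁.comp ((contMDiff_legendre hL₂).comp (contMDiff_psi h hL β A hL₂))
  have hl₁ := contMDiff_pi₁.comp
    (contMDiff_legendre (contMDiff_inducedLagrangian h hL β A hL₂))
  have e₂ := pullback_canonicalOneForm_apply (hl₂.mdifferentiable (by simp) s) X
  have e₁ := pullback_canonicalOneForm_apply (hl₁.mdifferentiable (by simp) s) X
  have hg : MDifferentiableAt 𝓘(ℝ, EP₁) 𝓘(ℝ, EQ₂) (fun p : P₁ => ε₂ (F p)) (tau₂ s) :=
    (ε₂.contMDiff.comp F.contMDiff).mdifferentiable (by simp) _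
  have ht : MDifferentiableAt (TPModel EP₁ EQ₁) 𝓘(ℝ, EP₁) (tau₂ : TP ε₁ → P₁) s :=
    contMDiff_tau₂.mdifferentiable (by simp) s
  have hf : MDifferentiableAt 𝓘(ℝ, EQ₂) 𝓘(ℝ, EQ₁) f (ε₂ (F (tau₂ s))) :=
    f.contMDiff.mdifferentiable (by simp) _
  have c₂ : mfderiv (TPModel EP₁ EQ₁) 𝓘(ℝ, EQ₂) (fun s : TP ε₁ => ε₂ (F (tau₂ s))) s = _ :=
    mfderiv_comp (g := fun p : P₁ => ε₂ (F p)) s hg ht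
  have c₁ : mfderiv (TPModel EP₁ EQ₁) 𝓘(ℝ, EQ₁) (fun s : TP ε₁ => f (ε₂ (F (tau₂ s)))) s = _ :=
    mfderiv_comp (g := f) s hf (MDifferentiableAt.comp (g := fun p : P₁ => ε₂ (F p)) s hg ht)
  have hcomm : (fun s : TP ε₁ => f (ε₂ (F (tau₂ s)))) = fun s => ε₁ (tau₂ s) :=
    funext fun s => h.comm s.proj
  let Y : TangentSpace 𝓘(ℝ, EQ₂) (ε₂ (F s.proj)) :=
    mfderiv (TPModel EP₁ EQ₁) 𝓘(ℝ, EQ₂) (fun s : TP ε₁ => ε₂ (F (tau₂ s))) s (X 0)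
  have hY : (show EQ₁ from mfderiv (TPModel EP₁ EQ₁) 𝓘(ℝ, EQ₁) (fun s : TP ε₁ => ε₁ (tau₂ s)) s
      (X 0)) = mfderiv 𝓘(ℝ, EQ₂) 𝓘(ℝ, EQ₁) f (ε₂ (F s.proj)) Y := by
    rw [← hcomm]
    exact congrArg (fun l : EP₁ × EQ₁ →L[ℝ] EQ₁ => l (X 0)) c₁
  have hβ : DForm.pullback (tau₂ : TP ε₁ → P₁) (betaConnection β A) s X =
      β.toFun s.proj (A.toFun (ε₂ (F s.proj)) Y) := by
    have h1 : Y = _ := congrArg (fun l : EP₁ × EQ₁ →L[ℝ] EQ₂ => l (X 0)) c₂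
    rw [h1]
    rfl
  have hk := fiberCovector_inducedLagrangian h hL β A hL₂ s Y
  rw [← hY, ← hβ] at hk
  exact e₂.trans (hk.trans (congrArg (· + _) e₁.symm))

theorem pullback_psi_poincareCartan (hL₂ : ContMDiff (TPModel EP₂ EQ₂) 𝓘(ℝ) ∞ L₂)
    (B₂ : DForm 𝓘(ℝ, EP₂) P₂ 2) :
    DForm.pullback (psi h hL β) (poincareCartan L₂ B₂) =
      poincareCartan (inducedLagrangian h hL β A) (inducedMagnetic β A B₂) := by
  have hψ := contMDiff_psi h hL β A hL₂
  have hL₁ := contMDiff_inducedLagrangian h hL β A hL₂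
  have hβ : (betaConnection β A).IsSmooth := isSmooth_betaConnection β A
  have hl₂ := contMDiff_pi₁.comp (contMDiff_legendre hL₂)
  have hl₁ := contMDiff_pi₁.comp (contMDiff_legendre hL₁)
  have hθ₂ := isSmooth_canonicalOneForm.pullback hl₂
  have hθ₁ := isSmooth_canonicalOneForm.pullback hl₁
  -- Both sides pull `B₂` back along the same map, as `τ₂ ∘ ψ = F ∘ τ₂` by definition of `ψ`.
  have hM : DForm.pullback (I := TPModel EP₁ EQ₁) (psi h hL β) (DForm.pullback (I := TPModel EP₂ EQ₂) tau₂ B₂) =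
      DForm.pullback (I := TPModel EP₁ EQ₁) (tau₂ : TP ε₁ → P₁) (DForm.pullback (I := 𝓘(ℝ, EP₁)) F B₂) := by
    rw [DForm.pullback_pullback _ (hψ.mdifferentiable (by simp))
      (contMDiff_tau₂.mdifferentiable (by simp)),
      DForm.pullback_pullback _ (contMDiff_tau₂.mdifferentiable (by simp))
      (F.contMDiff.mdifferentiable (by simp))]
    rfl
  have hd : DForm.pullback (I := TPModel EP₁ EQ₁) (psi h hL β) (DForm.pullback (I := TPModel EP₂ EQ₂)
        (fun s => pi₁ (legendre L₂ s)) (canonicalOneForm EQ₂ Q₂)).d =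
      (DForm.pullback (I := TPModel EP₁ EQ₁)
        (fun s => pi₁ (legendre (inducedLagrangian h hL β A) s)) (canonicalOneForm EQ₁ Q₁)).d +
      DForm.pullback (I := TPModel EP₁ EQ₁) (tau₂ : TP ε₁ → P₁) (betaConnection β A).d := by
    have h1 : DForm.pullback (I := TPModel EP₁ EQ₁) (tau₂ : TP ε₁ → P₁) (betaConnection β A).d =
        (DForm.pullback (I := TPModel EP₁ EQ₁) (tau₂ : TP ε₁ → P₁) (betaConnection β A)).d :=
      funext fun s => (DForm.d_pullback hβ (contMDiff_tau₂ s)).symm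
    have h2 := DForm.d_add hθ₁ (hβ.pullback contMDiff_tau₂)
    have h3 := pullback_psi_canonicalOneForm h hL β A hL₂
    have h4 := DForm.pullback_pullback (canonicalOneForm EQ₂ Q₂) (hψ.mdifferentiable (by simp))
      (hl₂.mdifferentiable (by simp))
    rw [h1]
    refine Eq.trans (funext fun s => (DForm.d_pullback hθ₂ (hψ s)).symm) ?_
    exact (congrArg DForm.d (h4.trans h3)).trans h2
  rw [poincareCartan_eq hL₂, poincareCartan_eq hL₁, DForm.pullback_add, hd, hM, inducedMagnetic,
    DForm.pullback_add]
  abel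

end Reduction

end MagLag

theorem mainTheorem1
    {EP₁ : Type*} [NormedAddCommGroup EP₁] [NormedSpace ℝ EP₁] [FiniteDimensional ℝ EP₁]
    {EQ₁ : Type*} [NormedAddCommGroup EQ₁] [NormedSpace ℝ EQ₁] [FiniteDimensional ℝ EQ₁]
    {EP₂ : Type*} [NormedAddCommGroup EP₂] [NormedSpace ℝ EP₂] [FiniteDimensional ℝ EP₂]
    {EQ₂ : Type*} [NormedAddCommGroup EQ₂] [NormedSpace ℝ EQ₂] [FiniteDimensional ℝ EQ₂]
    {P₁ : Type*} [TopologicalSpace P₁] [ChartedSpace EP₁ P₁] [IsManifold 𝓘(ℝ, EP₁) ∞ P₁]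
    {Q₁ : Type*} [TopologicalSpace Q₁] [ChartedSpace EQ₁ Q₁] [IsManifold 𝓘(ℝ, EQ₁) ∞ Q₁]
    {P₂ : Type*} [TopologicalSpace P₂] [ChartedSpace EP₂ P₂] [IsManifold 𝓘(ℝ, EP₂) ∞ P₂]
    {Q₂ : Type*} [TopologicalSpace Q₂] [ChartedSpace EQ₂ Q₂] [IsManifold 𝓘(ℝ, EQ₂) ∞ Q₂]
    (ε₁ : C^∞⟮𝓘(ℝ, EP₁), P₁; 𝓘(ℝ, EQ₁), Q₁⟯) (ε₂ : C^∞⟮𝓘(ℝ, EP₂), P₂; 𝓘(ℝ, EQ₂), Q₂⟯)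
    (F : C^∞⟮𝓘(ℝ, EP₁), P₁; 𝓘(ℝ, EP₂), P₂⟯) (f : C^∞⟮𝓘(ℝ, EQ₂), Q₂; 𝓘(ℝ, EQ₁), Q₁⟯)
    (h : IsTransformationPair ε₁ ε₂ F f)
    (L₂ : TP ε₂ → ℝ) (B₂ : DForm 𝓘(ℝ, EP₂) P₂ 2)
    (hS : IsMagneticLagrangianSystem ε₂ L₂ B₂) (hL : IsFRegular f L₂)
    (A : Connection f)
    (β : VDualMap (ES := EP₁) f (fun p : P₁ => ε₂ (F p))) :
    IsCompatibleMap F f (psi h hL β) ∧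
    IsMagneticLagrangianSystem ε₁ (inducedLagrangian h hL β A) (inducedMagnetic β A B₂) ∧
    DForm.pullback (psi h hL β) (poincareCartan L₂ B₂) =
      poincareCartan (inducedLagrangian h hL β A) (inducedMagnetic β A B₂) ∧
    (fun s => energy L₂ (psi h hL β s)) = energy (inducedLagrangian h hL β A) :=
  ⟨⟨contMDiff_psi h hL β A hS.contMDiff_lagrangian, compatible_psi h hL β⟩,
    ⟨h.fiberBundle_ε₁, contMDiff_inducedLagrangian h hL β A hS.contMDiff_lagrangian,
      isSmooth_inducedMagnetic β A hS.smooth_magnetic,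
      d_inducedMagnetic β A hS.smooth_magnetic hS.closed_magnetic⟩,
    pullback_psi_poincareCartan h hL β A hS.contMDiff_lagrangian B₂,
    funext (energy_psi h hL β A hS.contMDiff_lagrangian)⟩
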